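/- Let $k$ be an algebraically closed field of characteristic zero, let $A$ be a finite-dimensional semisimple Hopf algebra over $k$ with comultiplication $\Delta(a)=a_1\otimes a_2$, counit $\epsilon$ and antipode $S$, and let $B\subseteq A$ be a normal Hopf subalgebra, i.e. a Hopf subalgebra with $a_1BS(a_2)\subseteq B$ for all $a\in A$. Let $A^*$ be the dual algebra with the convolution product, and let $\mathrm{Irr}(A^*)\subseteq A=A^{**}$ be the set of characters of the simple left $A^*$-modules. For $d\in \mathrm{Irr}(A^*)$ put $d^*=S(d)$. Let $\alpha$ be the character of an irreducible (left) $B$-module, and for $d\in\mathrm{Irr}(A^*)$ let ${}^d\alpha$ be the conjugate character ${}^d\alpha(x)=\alpha(S(d_1)\,x\,d_2)$, $x\in B$ (this is well defined, since also $S(a_1)Ba_2\subseteq B$ for all $a\in A$). Put $$X=\{d\in \mathrm{Irr}(A^*)\mid {}^d\alpha=\epsilon(d)\,\alpha\}.$$ Then $X$ is closed under multiplication and under $*$: for $d,d'\in X$ the product $dd'$ is a sum of elements of $\mathrm{Irr}(A^*)$, all irreducible constituents of $dd'$ belong to $X$, and $d^*\in X$. Consequently $X$ generates a Hopf subalgebra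 $Z$ of $A$, the stabilizer of $\alpha$, which contains $B$: the sum of all simple subcoalgebras $C$ of $A$ that contain an element of $X$ (equivalently, whose irreducible character lies in $X$) is direct, it is a Hopf subalgebra $Z=\bigoplus_C C$ of $A$, it is the smallest Hopf subalgebra of $A$ containing $X$, and $B\subseteq Z$. -/

import Mathlib

open scoped TensorProduct
open Coalgebra HopfAlgebra

namespace HopfClifford
universe u v w

section Antipode
variable {k : Type u} {A : Type v} [Field k] [Ring A] [HopfAlgebra k A]

theorem exists_integral [IsSemisimpleRing A] :
    ∃ t : A, (∀ a : A, a * t = counit (R := k) a • t) ∧ counit (R := k) t = 1 := by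
  let I : Ideal A := RingHom.ker (Bialgebra.counitAlgHom k A)
  have hI : ∀ a : A, a ∈ I ↔ counit (R := k) a = 0 := fun a => Iff.rfl
  obtain ⟨J, hJ⟩ := exists_isCompl I
  have h1 : (1 : A) ∈ I ⊔ J := by rw [hJ.sup_eq_top]; trivial
  obtain ⟨i, hi, j, hj, hij⟩ := Submodule.mem_sup.1 h1
  have hεj : counit (R := k) j = 1 := by
    have := congrArg (counit (R := k)) hij
    rwa [map_add, (hI i).1 hi, zero_add, Bialgebra.counit_one] at this
  refine ⟨j, fun a => ?_, hεj⟩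
  have hmem : a * j - counit (R := k) a • j ∈ J := by
    refine J.sub_mem (J.smul_mem a hj) ?_
    rw [← smul_one_mul]
    exact J.smul_mem _ hj
  have hmemI : a * j - counit (R := k) a • j ∈ I := by
    rw [hI]; simp [hεj]
  have := (Submodule.disjoint_def.1 hJ.disjoint) _ hmemI hmem
  exact sub_eq_zero.1 this

theorem sum_antipode_tmul_one_mul_comul (a : A) :
    ∑ i ∈ (ℛ k a).index, ((antipode k ((ℛ k a).left i)) ⊗ₜ[k] (1 : A)) *
      comul ((ℛ k a).right i) = (1 : A) ⊗ₜ[k] a := by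
  have h := sum_tmul_tmul_eq (ℛ k a) (fun i => ℛ k ((ℛ k a).left i))
    (fun i => ℛ k ((ℛ k a).right i))
  let F : A ⊗[k] (A ⊗[k] A) →ₗ[k] A ⊗[k] A :=
    (LinearMap.mul' k A ∘ₗ (antipode k).rTensor A).rTensor A ∘ₗ
      (TensorProduct.assoc k A A A).symm.toLinearMap
  have hF := congrArg F h
  have e : ∀ x y z : A, F (x ⊗ₜ (y ⊗ₜ z)) = (antipode k x * y) ⊗ₜ z := fun x y z => by simp [F]
  simp only [map_sum, e] at hF
  calc _ = ∑ i ∈ (ℛ k a).index, ∑ j ∈ (ℛ k ((ℛ k a).right i)).index,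
        (antipode k ((ℛ k a).left i) * (ℛ k ((ℛ k a).right i)).left j) ⊗ₜ[k]
          (ℛ k ((ℛ k a).right i)).right j := by
        refine Finset.sum_congr rfl fun i _ => ?_
        rw [← (ℛ k ((ℛ k a).right i)).eq, Finset.mul_sum]
        simp
    _ = _ := by
        rw [← hF]
        simp_rw [← TensorProduct.sum_tmul, sum_antipode_mul_eq_smul, TensorProduct.smul_tmul,
          ← TensorProduct.tmul_sum, sum_counit_smul]

theorem antipode_injective [FiniteDimensional k A] [IsSemisimpleRing A] :
    Function.Injective (antipode k (A := A)) := by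
  obtain ⟨t, ht, ht1⟩ := exists_integral (k := k) (A := A)
  have rel : ∀ a : A, ((1 : A) ⊗ₜ[k] a) * comul t = (antipode k a ⊗ₜ[k] (1 : A)) * comul t := by
    intro a
    rw [← sum_antipode_tmul_one_mul_comul, Finset.sum_mul]
    simp_rw [mul_assoc, ← Bialgebra.comul_mul, ht, map_smul, mul_smul_comm, ← smul_mul_assoc,
      ← Finset.sum_mul, TensorProduct.smul_tmul', ← TensorProduct.sum_tmul, ← map_smul, ← map_sum]
    congr 3
    have h2 := congrArg (TensorProduct.rid k A) (sum_tmul_counit_eq (R := k) (ℛ k a))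
    simpa only [map_sum, TensorProduct.rid_tmul, one_smul] using h2
  rw [injective_iff_map_eq_zero]
  intro a ha
  have hz : ∀ b : A, ((1 : A) ⊗ₜ[k] (a * b)) * comul t = 0 := by
    intro b
    have e1 : ((1 : A) ⊗ₜ[k] (a * b)) = ((1 : A) ⊗ₜ[k] a) * ((1 : A) ⊗ₜ[k] b) := by simp
    have e2 : ((1 : A) ⊗ₜ[k] a) * (antipode k b ⊗ₜ[k] (1 : A)) =
      (antipode k b ⊗ₜ[k] (1 : A)) * ((1 : A) ⊗ₜ[k] a) := by simp
    rw [e1, mul_assoc, rel b, ← mul_assoc, e2, mul_assoc, rel a, ha]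
    simp
  let e := Module.finBasis k A
  have key : ∀ x : A ⊗[k] A, a * LinearMap.mul' k A ((antipode k).rTensor A x) =
      ∑ i, TensorProduct.lid k A ((e.coord i).rTensor A
        (((1 : A) ⊗ₜ[k] (a * antipode k (e i))) * x)) := by
    intro x
    induction x with
    | zero => simp
    | add x y hx hy => simp only [map_add, mul_add, hx, hy, Finset.sum_add_distrib]
    | tmul u w =>
      simp only [LinearMap.rTensor_tmul, LinearMap.mul'_apply,
        Algebra.TensorProduct.tmul_mul_tmul, one_mul, TensorProduct.lid_tmul]
      conv_lhs => rw [← e.sum_repr u]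
      simp only [map_sum, map_smul, Finset.sum_mul, Finset.mul_sum, smul_mul_assoc, mul_smul_comm,
        Module.Basis.coord_apply, mul_assoc]
  have := key (comul t)
  simpa [hz, ht1] using this

theorem comul_antipode_eq (a : A) :
    comul (R := k) (antipode k a) =
      TensorProduct.comm k A A (TensorProduct.map (antipode k) (antipode k) (comul a)) := by
  let G : A →ₗ[k] A ⊗[k] A := (TensorProduct.comm k A A).toLinearMap ∘ₗ
    TensorProduct.map (antipode k) (antipode k) ∘ₗ comul
  have hG : WithConv.toConv G * WithConv.toConv (comul (R := k) (A := A)) = 1 := by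
    ext c
    rw [(ℛ k c).convMul_apply]
    have h := sum_tmul_tmul_eq (ℛ k c) (fun i => ℛ k ((ℛ k c).left i))
      (fun i => ℛ k ((ℛ k c).right i))
    let F : A ⊗[k] (A ⊗[k] A) →ₗ[k] A ⊗[k] A :=
      LinearMap.mul' k (A ⊗[k] A) ∘ₗ
        TensorProduct.map ((TensorProduct.comm k A A).toLinearMap ∘ₗ
          TensorProduct.map (antipode k) (antipode k)) comul ∘ₗ
        (TensorProduct.assoc k A A A).symm.toLinearMap
    have hF := congrArg F h
    have e : ∀ x y z : A, F (x ⊗ₜ (y ⊗ₜ z)) = (antipode k y ⊗ₜ antipode k x) * comul z :=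
      fun x y z => by simp [F]
    simp only [map_sum, e] at hF
    have e1 : ∀ i, G ((ℛ k c).left i) = ∑ j ∈ (ℛ k ((ℛ k c).left i)).index,
        antipode k ((ℛ k ((ℛ k c).left i)).right j) ⊗ₜ[k]
          antipode k ((ℛ k ((ℛ k c).left i)).left j) := by
      intro i
      simp only [G, LinearMap.comp_apply]
      conv_lhs => rw [← (ℛ k ((ℛ k c).left i)).eq]
      simp
    have e2 : ∀ i (y z : A), (antipode k y ⊗ₜ[k] antipode k ((ℛ k c).left i)) * comul z =
        ((1 : A) ⊗ₜ[k] antipode k ((ℛ k c).left i)) * ((antipode k y ⊗ₜ[k] (1 : A)) * comul z) := by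
      intro i y z
      rw [← mul_assoc]; simp
    simp only [e1, Finset.sum_mul]
    rw [hF]
    simp_rw [e2, ← Finset.mul_sum, sum_antipode_tmul_one_mul_comul,
      Algebra.TensorProduct.tmul_mul_tmul, ← TensorProduct.tmul_sum,
      sum_antipode_mul_eq_algebraMap_counit]
    simp [Algebra.algebraMap_eq_smul_one, Algebra.TensorProduct.one_def]
  have := left_inv_eq_right_inv hG LinearMap.comul_right_inv
  exact (LinearMap.congr_fun (WithConv.toConv_injective this) a).symm

end Antipode

section HopfSubalgebra
variable {k : Type u} {A : Type v} [Field k] [Ring A] [HopfAlgebra k A]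

/-- A Hopf subalgebra: a subalgebra `B` with `Δ(B) ⊆ B ⊗ B` and `S(B) ⊆ B`. -/
structure IsHopfSubalgebra (B : Subalgebra k A) : Prop where
  comul_mem : ∀ b ∈ B, comul (R := k) b ∈
    LinearMap.range (TensorProduct.map B.val.toLinearMap B.val.toLinearMap)
  antipode_mem : ∀ b ∈ B, antipode k b ∈ B

variable (k A) in
/-- The bilinear map `a ⊗ a' ↦ (x ↦ a * x * a')`. -/
noncomputable def sandwich : A ⊗[k] A →ₗ[k] A →ₗ[k] A :=
  TensorProduct.lift (LinearMap.mk₂ k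
    (fun a a' => LinearMap.mulLeft k a ∘ₗ LinearMap.mulRight k a')
    (fun _ _ _ => by ext; simp [add_mul]) (fun _ _ _ => by ext; simp)
    (fun _ _ _ => by ext; simp [mul_add]) (fun _ _ _ => by ext; simp))

@[simp] theorem sandwich_tmul (a a' x : A) : sandwich k A (a ⊗ₜ a') x = a * x * a' := by
  simp [sandwich, mul_assoc]

variable (k A) in
/-- The left adjoint action `a ↦ (x ↦ a₁ x S(a₂))`. -/
noncomputable def leftAdjoint : A →ₗ[k] A →ₗ[k] A :=
  sandwich k A ∘ₗ (antipode k).lTensor A ∘ₗ comul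

variable (k A) in
/-- The right adjoint action `a ↦ (x ↦ S(a₁) x a₂)`. -/
noncomputable def rightAdjoint : A →ₗ[k] A →ₗ[k] A :=
  sandwich k A ∘ₗ (antipode k).rTensor A ∘ₗ comul

/-- A normal Hopf subalgebra: a Hopf subalgebra `B` with `a₁ B S(a₂) ⊆ B` for all `a ∈ A`. -/
structure IsNormalHopfSubalgebra (B : Subalgebra k A) : Prop extends IsHopfSubalgebra B where
  leftAdjoint_mem : ∀ a : A, ∀ b ∈ B, leftAdjoint k A a b ∈ B

theorem antipode_rightAdjoint (a x : A) :
    antipode k (rightAdjoint k A a x) = leftAdjoint k A (antipode k a) (antipode k x) := by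
  simp only [rightAdjoint, leftAdjoint, LinearMap.comp_apply, comul_antipode_eq]
  induction comul (R := k) a with
  | zero => simp
  | add u w hu hw => simp only [map_add, LinearMap.add_apply, hu, hw]
  | tmul u w => simp [antipode_mul_antidistrib, mul_assoc]

theorem rightAdjoint_one (a : A) : rightAdjoint k A a 1 = counit (R := k) a • (1 : A) := by
  simp only [rightAdjoint, LinearMap.comp_apply]
  rw [← (ℛ k a).eq]
  simp [sum_antipode_mul_eq_smul]

theorem rightAdjoint_apply (a x : A) : rightAdjoint k A a x =
    ∑ i ∈ (ℛ k a).index, antipode k ((ℛ k a).left i) * x * (ℛ k a).right i := by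
  simp only [rightAdjoint, LinearMap.comp_apply]
  conv_lhs => rw [← (ℛ k a).eq]
  simp

theorem sum_mul_rightAdjoint (a y : A) :
    ∑ i ∈ (ℛ k a).index, (ℛ k a).left i * rightAdjoint k A ((ℛ k a).right i) y = y * a := by
  have h := sum_tmul_tmul_eq (ℛ k a) (fun i => ℛ k ((ℛ k a).left i))
    (fun i => ℛ k ((ℛ k a).right i))
  let F : A ⊗[k] (A ⊗[k] A) →ₗ[k] A :=
    LinearMap.mul' k A ∘ₗ
      TensorProduct.map (LinearMap.mulRight k y ∘ₗ LinearMap.mul' k A ∘ₗ (antipode k).lTensor A)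
        LinearMap.id ∘ₗ (TensorProduct.assoc k A A A).symm.toLinearMap
  have hF := congrArg F h
  have e : ∀ u v w : A, F (u ⊗ₜ (v ⊗ₜ w)) = u * antipode k v * y * w := fun u v w => by simp [F]
  simp only [map_sum, e] at hF
  simp_rw [rightAdjoint_apply, Finset.mul_sum, ← mul_assoc]
  rw [← hF]
  simp_rw [← Finset.sum_mul, sum_mul_antipode_eq_smul, smul_one_mul, smul_mul_assoc,
    ← mul_smul_comm, ← Finset.mul_sum, sum_counit_smul]

theorem rightAdjoint_mul (a x y : A) : rightAdjoint k A a (x * y) =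
    ∑ i ∈ (ℛ k a).index, rightAdjoint k A ((ℛ k a).left i) x *
      rightAdjoint k A ((ℛ k a).right i) y := by
  have h := sum_tmul_tmul_eq (ℛ k a) (fun i => ℛ k ((ℛ k a).left i))
    (fun i => ℛ k ((ℛ k a).right i))
  let F : A ⊗[k] (A ⊗[k] A) →ₗ[k] A :=
    LinearMap.mul' k A ∘ₗ
      TensorProduct.map (LinearMap.mulRight k x ∘ₗ antipode k)
        (LinearMap.mul' k A ∘ₗ ((rightAdjoint k A).flip y).lTensor A)
  have hF := congrArg F h
  have e : ∀ u v w : A, F (u ⊗ₜ (v ⊗ₜ w)) = antipode k u * x * (v * rightAdjoint k A w y) :=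
    fun u v w => by simp [F]
  simp only [map_sum, e] at hF
  simp_rw [← Finset.mul_sum, sum_mul_rightAdjoint] at hF
  rw [rightAdjoint_apply]
  simp_rw [← mul_assoc] at hF ⊢
  rw [← hF]
  refine Finset.sum_congr rfl fun i _ => ?_
  rw [rightAdjoint_apply ((ℛ k a).left i), Finset.sum_mul]

variable [FiniteDimensional k A] [IsSemisimpleRing A] {B : Subalgebra k A}

/-- If `B` is normal then also `S(a₁) B a₂ ⊆ B`. -/
theorem IsNormalHopfSubalgebra.rightAdjoint_mem (hB : IsNormalHopfSubalgebra B) (a x : A)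
    (hx : x ∈ B) : rightAdjoint k A a x ∈ B := by
  let s : B.toSubmodule →ₗ[k] B.toSubmodule := (antipode k).restrict hB.antipode_mem
  have hs : Function.Surjective s := by
    refine LinearMap.surjective_of_injective fun y z h => ?_
    exact Subtype.ext (antipode_injective (k := k) (congrArg Subtype.val h))
  obtain ⟨y, hy⟩ := hs ⟨_, hB.leftAdjoint_mem (antipode k a) _ (hB.antipode_mem x hx)⟩
  have h := congrArg Subtype.val hy
  have : antipode k (y : A) = antipode k (rightAdjoint k A a x) := by
    rw [antipode_rightAdjoint]; exact h
  rw [← antipode_injective this]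
  exact y.2

/-- The right adjoint action of `A` on a normal Hopf subalgebra `B`, `a ↦ (x ↦ S(a₁) x a₂)`. -/
noncomputable def IsNormalHopfSubalgebra.adj (hB : IsNormalHopfSubalgebra B) :
    A →ₗ[k] B →ₗ[k] B where
  toFun a := ((rightAdjoint k A a).restrict (p := B.toSubmodule) (q := B.toSubmodule)
    (hB.rightAdjoint_mem a) : B.toSubmodule →ₗ[k] B.toSubmodule)
  map_add' _ _ := by ext; simp
  map_smul' _ _ := by ext; simp

@[simp] theorem IsNormalHopfSubalgebra.coe_adj (hB : IsNormalHopfSubalgebra B) (a : A) (x : B) :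
    (hB.adj a x : A) = rightAdjoint k A a x := rfl

theorem IsNormalHopfSubalgebra.adj_one (hB : IsNormalHopfSubalgebra B) (a : A) :
    hB.adj a 1 = counit (R := k) a • (1 : B) :=
  Subtype.ext (rightAdjoint_one a)

theorem IsNormalHopfSubalgebra.adj_mul (hB : IsNormalHopfSubalgebra B) (a : A) (x y : B) :
    hB.adj a (x * y) = ∑ i ∈ (ℛ k a).index, hB.adj ((ℛ k a).left i) x *
      hB.adj ((ℛ k a).right i) y := by
  apply Subtype.ext
  simp [rightAdjoint_mul]

end HopfSubalgebra

section Characters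

/-- The character `r ↦ tr(r : V → V)` of a module `V` over a `k`-algebra `R`. -/
noncomputable def moduleCharacter (k : Type u) {R : Type w} [Field k] [Ring R] [Algebra k R]
    (V : Type*) [AddCommGroup V] [Module k V] [Module R V] [IsScalarTower k R V] : R →ₗ[k] k :=
  LinearMap.trace k V ∘ₗ (Algebra.lsmul k k V : R →ₐ[k] Module.End k V).toLinearMap

/-- `χ` is the character of a simple finite-dimensional left `R`-module. -/
def IsIrreducibleCharacter {k : Type u} {R : Type w} [Field k] [Ring R] [Algebra k R]
    (χ : R →ₗ[k] k) : Prop :=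
  ∃ (V : Type w) (_ : AddCommGroup V) (_ : Module k V) (_ : Module R V)
    (_ : IsScalarTower k R V) (_ : FiniteDimensional k V),
    IsSimpleModule R V ∧ χ = moduleCharacter k V

variable (k : Type u) (A : Type v) [Field k] [Ring A] [HopfAlgebra k A]

/-- The dual algebra `A*`, with the convolution product `(f * g)(a) = f(a₁) g(a₂)`. -/
abbrev DualAlgebra : Type (max v u) := WithConv (A →ₗ[k] k)

variable {A}

/-- An element `d` of `A`, viewed as the linear functional `f ↦ f(d)` on `A*`. -/
noncomputable def evalFunctional (d : A) : DualAlgebra k A →ₗ[k] k where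
  toFun f := f d
  map_add' _ _ := rfl
  map_smul' _ _ := rfl

variable (A) in
/-- `Irr(A*)`: the characters of the simple left `A*`-modules, as elements of `A = A**`. -/
def irrDual : Set A := {d | IsIrreducibleCharacter (evalFunctional k d)}

end Characters

section Conjugate
variable {k : Type u} {A : Type v} [Field k] [Ring A] [HopfAlgebra k A]
variable [FiniteDimensional k A]

section
variable (k A)
variable (W : Type*) [AddCommGroup W] [Module k W] [Module (DualAlgebra k A) W]
  [IsScalarTower k (DualAlgebra k A) W]

theorem dual_expansion (f : DualAlgebra k A) :
    f = ∑ i, f (Module.finBasis k A i) •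
      (WithConv.toConv ((Module.finBasis k A).coord i) : DualAlgebra k A) := by
  have h := (Module.finBasis k A).sum_dual_apply_smul_coord f.ofConv
  have h2 := congrArg (WithConv.linearEquiv k (A →ₗ[k] k)).symm h
  simp only [map_sum, map_smul] at h2
  exact h2.symm

/-- The right `A`-comodule structure `w ↦ w₀ ⊗ w₁` of a left `A*`-module `W`: the map
`w ↦ ∑ᵢ (eⁱ • w) ⊗ eᵢ`, for a basis `eᵢ` of `A` with dual basis `eⁱ`. -/
noncomputable def coaction : W →ₗ[k] W ⊗[k] A :=
  ∑ i, (TensorProduct.mk k W A).flip (Module.finBasis k A i) ∘ₗ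
    Algebra.lsmul k k W (WithConv.toConv ((Module.finBasis k A).coord i) : DualAlgebra k A)

/-- `w₀ ⊗ w₁` is characterised by `f • w = f(w₁) w₀` for all `f ∈ A*`. -/
theorem smul_eq_coaction (f : DualAlgebra k A) (w : W) :
    f • w = TensorProduct.rid k W ((f.ofConv).lTensor W (coaction k A W w)) := by
  conv_lhs => rw [dual_expansion k A f]
  simp [coaction, Finset.sum_smul]
end

variable [IsSemisimpleRing A] {B : Subalgebra k A} (hB : IsNormalHopfSubalgebra B)
variable (W : Type*) [AddCommGroup W] [Module k W] [Module (DualAlgebra k A) W]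
  [IsScalarTower k (DualAlgebra k A) W]
variable (M : Type*) [AddCommGroup M] [Module k M] [Module B M] [IsScalarTower k B M]

/-- The action `w ⊗ m ↦ w₀ ⊗ (S(w₁) b w₂) m` of `b ∈ B` on `W ⊗ M`. -/
noncomputable def conjAction (b : B) : Module.End k (W ⊗[k] M) :=
  (TensorProduct.lift ((Algebra.lsmul k k M : B →ₐ[k] Module.End k M).toLinearMap ∘ₗ
      hB.adj.flip b)).lTensor W ∘ₗ
    (TensorProduct.assoc k W A M).toLinearMap ∘ₗ (coaction k A W).rTensor M

theorem conjAction_eq_sum (b : B) : conjAction hB W M b =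
    ∑ i, TensorProduct.map
      (Algebra.lsmul k k W (WithConv.toConv ((Module.finBasis k A).coord i) : DualAlgebra k A))
      (Algebra.lsmul k k M (hB.adj (Module.finBasis k A i) b)) := by
  ext w m
  simp [conjAction, coaction, TensorProduct.sum_tmul]

theorem conjAction_one : conjAction hB W M 1 = 1 := by
  have h := dual_expansion k A (1 : DualAlgebra k A)
  simp only [LinearMap.convOne_apply, Algebra.algebraMap_self, RingHom.id_apply] at h
  rw [conjAction_eq_sum]
  simp_rw [IsNormalHopfSubalgebra.adj_one, map_smul, map_one, TensorProduct.map_smul_right,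
    ← TensorProduct.map_smul_left, ← map_smul]
  ext w m
  simp only [TensorProduct.AlgebraTensorModule.curry_apply, LinearMap.restrictScalars_self,
    TensorProduct.curry_apply, LinearMap.sum_apply, TensorProduct.map_tmul, Module.End.one_apply,
    ← TensorProduct.sum_tmul]
  congr 1
  conv_rhs => rw [← one_smul (DualAlgebra k A) w, h, Finset.sum_smul]
  rfl

theorem conjAction_mul (x y : B) :
    conjAction hB W M (x * y) = conjAction hB W M x * conjAction hB W M y := by
  let e := Module.finBasis k A
  let L : DualAlgebra k A →ₐ[k] Module.End k W := Algebra.lsmul k k W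
  let N : B →ₐ[k] Module.End k M := Algebra.lsmul k k M
  let E : Fin (Module.finrank k A) → DualAlgebra k A := fun i => WithConv.toConv (e.coord i)
  have hexp : ∀ f : DualAlgebra k A, f = ∑ i, f (e i) • E i := dual_expansion k A
  let P : A ⊗[k] A →ₗ[k] B := LinearMap.mul' k B ∘ₗ
    TensorProduct.map (hB.adj.flip x) (hB.adj.flip y)
  have hP : ∀ a : A, hB.adj a (x * y) = P (comul a) := fun a => by
    rw [hB.adj_mul]
    conv_rhs => rw [← (ℛ k a).eq]
    simp [P]
  have hP2 : ∀ a : A, P (comul a) =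
      ∑ i, ∑ j, (E i * E j) a • (hB.adj (e i) x * hB.adj (e j) y) := by
    intro a
    have : ∀ t : A ⊗[k] A, P t = ∑ i, ∑ j,
        LinearMap.mul' k k (TensorProduct.map (e.coord i) (e.coord j) t) •
          (hB.adj (e i) x * hB.adj (e j) y) := by
      intro t
      induction t with
      | zero => simp
      | add t s ht hs => simp only [map_add, add_smul, ht, hs, Finset.sum_add_distrib]
      | tmul u v =>
        have hu : hB.adj u x = ∑ i, e.coord i u • hB.adj (e i) x := by
          conv_lhs => rw [← e.sum_repr u]
          simp only [map_sum, map_smul, LinearMap.sum_apply, LinearMap.smul_apply,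
            Module.Basis.coord_apply]
        have hv : hB.adj v y = ∑ i, e.coord i v • hB.adj (e i) y := by
          conv_lhs => rw [← e.sum_repr v]
          simp only [map_sum, map_smul, LinearMap.sum_apply, LinearMap.smul_apply,
            Module.Basis.coord_apply]
        simp only [P, LinearMap.comp_apply, TensorProduct.map_tmul, LinearMap.flip_apply,
          LinearMap.mul'_apply]
        rw [hu, hv, Finset.sum_mul_sum]
        simp only [smul_mul_smul_comm]
    exact this _
  have h1 : conjAction hB W M (x * y) =
      ∑ l, ∑ i, ∑ j, TensorProduct.map (L ((E i * E j) (e l) • E l))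
        (N (hB.adj (e i) x * hB.adj (e j) y)) := by
    rw [conjAction_eq_sum]
    refine Finset.sum_congr rfl fun l _ => ?_
    rw [hP, hP2]
    simp only [map_sum, map_smul, TensorProduct.map_smul_left, ← TensorProduct.map_smul_right]
    ext w m
    simp [TensorProduct.tmul_sum, N, L, E, e]
  have h2 : conjAction hB W M x * conjAction hB W M y =
      ∑ i, ∑ j, TensorProduct.map (L (E i * E j))
        (N (hB.adj (e i) x * hB.adj (e j) y)) := by
    rw [conjAction_eq_sum, conjAction_eq_sum, Finset.sum_mul_sum]
    refine Finset.sum_congr rfl fun i _ => Finset.sum_congr rfl fun j _ => ?_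
    rw [map_mul, map_mul, TensorProduct.map_mul]
  rw [h1, h2, Finset.sum_comm]
  refine Finset.sum_congr rfl fun i _ => ?_
  rw [Finset.sum_comm]
  refine Finset.sum_congr rfl fun j _ => ?_
  conv_rhs => rw [hexp (E i * E j)]
  ext w m
  simp [TensorProduct.sum_tmul]

/-- The conjugate `B`-module of `M` by `W`, as an algebra map `B → End(W ⊗ M)`. -/
noncomputable def conjModule : B →ₐ[k] Module.End k (W ⊗[k] M) :=
  AlgHom.ofLinearMap
    { toFun := conjAction hB W M
      map_add' := fun x y => by
        simp [conjAction_eq_sum, TensorProduct.map_add_right, Finset.sum_add_distrib]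
      map_smul' := fun c x => by
        simp [conjAction_eq_sum, TensorProduct.map_smul_right, Finset.smul_sum] }
    (conjAction_one hB W M) (conjAction_mul hB W M)

/-- The conjugate character `ᵈα : x ↦ α(S(d₁) x d₂)`. -/
noncomputable def conjCharacter (d : A) (α : B →ₗ[k] k) : B →ₗ[k] k :=
  α ∘ₗ hB.adj d

/-- If `d` is the character of `W` and `α` is the character of `M`, then `ᵈα` is the character
of the conjugate module of `M` by `W`. -/
theorem trace_conjModule [FiniteDimensional k W] [FiniteDimensional k M] (d : A)
    (hd : evalFunctional k d = moduleCharacter k W) (b : B) :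
    LinearMap.trace k (W ⊗[k] M) (conjModule hB W M b) =
      conjCharacter hB d (moduleCharacter k M) b := by
  have h1 : ∀ f : DualAlgebra k A, f d =
      LinearMap.trace k W (Algebra.lsmul k k W f) := fun f => LinearMap.congr_fun hd f
  have h2 : hB.adj d b = ∑ i, (Module.finBasis k A).coord i d •
      hB.adj (Module.finBasis k A i) b := by
    conv_lhs => rw [← (Module.finBasis k A).sum_repr d]
    simp only [map_sum, map_smul, LinearMap.sum_apply, LinearMap.smul_apply,
      Module.Basis.coord_apply]
  have h3 : conjModule hB W M b = conjAction hB W M b := rfl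
  rw [h3, conjAction_eq_sum, map_sum]
  simp_rw [LinearMap.trace_tensorProduct', ← h1]
  rw [conjCharacter, LinearMap.comp_apply, h2, map_sum]
  refine Finset.sum_congr rfl fun i _ => ?_
  rw [map_smul, smul_eq_mul]
  rfl

end Conjugate

section Stabilizer
variable {k : Type u} {A : Type v} [Field k] [Ring A] [HopfAlgebra k A]

/-- The stabilizing set `{d ∈ Irr(A*) | ᵈα = ε(d) α}` of a `B`-character `α`. -/
def stabilizerSet [FiniteDimensional k A] [IsSemisimpleRing A] {B : Subalgebra k A}
    (hB : IsNormalHopfSubalgebra B) (α : B →ₗ[k] k) : Set A :=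
  {d | d ∈ irrDual k A ∧ conjCharacter hB d α = counit (R := k) d • α}

variable (k) in
/-- `e` is an irreducible constituent of the `A*`-character `c`: it is irreducible, and `c - e` is
a sum (possibly empty) of irreducible characters. -/
def IsConstituent (e c : A) : Prop :=
  e ∈ irrDual k A ∧ ∃ r ∈ AddSubmonoid.closure (irrDual k A), c = e + r

variable (k) in
/-- A set `X` of irreducible `A*`-characters is closed under multiplication if, for `d, d' ∈ X`,
the product `d d'` decomposes into irreducible characters and all of its irreducible
constituents lie in `X`. -/
def IsClosedUnderMul (X : Set A) : Prop :=
  ∀ d ∈ X, ∀ d' ∈ X, d * d' ∈ AddSubmonoid.closure (irrDual k A) ∧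
    ∀ e : A, IsConstituent k e (d * d') → e ∈ X

variable (k) in
/-- A set `X` of irreducible `A*`-characters is closed under `*`, where `d* = S(d)` is the
character of the dual of the `A*`-module with character `d`. -/
def IsClosedUnderStar (X : Set A) : Prop :=
  ∀ d ∈ X, antipode k d ∈ X

/-- A subcoalgebra: a subspace `C` with `Δ(C) ⊆ C ⊗ C`. -/
def IsSubcoalgebra (C : Submodule k A) : Prop :=
  ∀ c ∈ C, comul (R := k) c ∈ LinearMap.range (TensorProduct.map C.subtype C.subtype)

/-- A simple subcoalgebra: a nonzero subcoalgebra without proper nonzero subcoalgebras. -/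
structure IsSimpleSubcoalgebra (C : Submodule k A) : Prop where
  isSubcoalgebra : IsSubcoalgebra C
  ne_bot : C ≠ ⊥
  eq_bot_or_eq : ∀ D : Submodule k A, IsSubcoalgebra D → D ≤ C → D = ⊥ ∨ D = C

/-- The simple subcoalgebras of `A` whose irreducible character lies in `X`. -/
def simpleSubcoalgebrasOf (X : Set A) : Set (Submodule k A) :=
  {C | IsSimpleSubcoalgebra C ∧ ∃ d ∈ X, d ∈ C}

end Stabilizer
end HopfClifford

/-!
The stabilizing set `X` is closed under multiplication because `a ↦ (x ↦ S(a₁) x a₂)` is a right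
action of `A` on `B`, so that conjugating `α` by `d d'` multiplies it by `ε(d) ε(d')`. If
`d d' = e + r`, the conjugates of `α` by `e` and by `r` are characters of `B` with sum a multiple of
`α`; as multiplicities are natural numbers and `k` has characteristic zero, the conjugate by `e` is
itself a multiple of `α`, and its value at `1` identifies the factor as `ε(e)`
(`conjCharacter_eq_of_add`).

Everything else rests on the theorem of Larson and Radford that `A` is cosemisimple, that is,
`A*` is a semisimple algebra (`isSemisimpleRing_dualAlgebra`). Let `t` be the normalized integral of
`A`, and `l` the functional with `l(t₁) t₂ = 1`. Then `l` is a Frobenius form and a right integral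
of `A*`, its Nakayama automorphism is `S²`, and `tr(S²) = l(1)`. As `A` is semisimple, `S²` is
conjugation by a unit `w`. As `A` is unimodular, `S⁴` is conjugation by a group-like element
(Radford), so `S²` has finite order. Hence the trace `∑ᵢ tr(wᵢ) tr(wᵢ⁻¹)` of `S²` over the simple
blocks is, after an embedding of the algebraic numbers of `k` into `ℂ`, a sum of squares
`|tr(wᵢ)|²`, not all zero. So `l(1) ≠ 0`, and averaging with `l` makes every left ideal of `A*` a
direct summand.

By Wedderburn's theorem `A*` is then a product of matrix algebras, and `A` has a dual basis of
comatrix elements `c^i_ab` with `Δ(c^i_ab) = ∑ⱼ c^i_aj ⊗ c^i_jb`. The simple subcoalgebras are the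
spans `Cᵢ` of the blocks of this basis, `Irr(A*)` consists of the traces `dᵢ = ∑ₐ c^i_aa`, and a
subcoalgebra contains `Cᵢ` as soon as one of its elements has a nonzero coefficient in the block `i`
(`IsSubcoalgebra.comatrix_mem`). Let `Z` be the sum of the `Cᵢ` with `dᵢ ∈ X`. A block `l` that meets
the product `Cᵢ Cⱼ` occurs in `dᵢ dⱼ`, its multiplicity being the rank of a nonzero idempotent
(`IsMultiplicativeMatrix.exists_sum_eq`); hence `Z` is a subalgebra. It is stable under `S`, because
`(S(c^i_ab))` is the inverse of a matrix with entries in the finite-dimensional algebra `Z`. Closure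
of `X` under `*` follows, since `S(dᵢ)` is an irreducible character that lies in `Z`. Finally
`B ⊆ Z`: for a block contained in `B`, cocommutativity of `dᵢ` and the trace property of `α` give
`α(S(d₁) x d₂) = α(x d₁ S(d₂)) = ε(d) α(x)`.
-/

namespace HopfClifford
universe u v w

/-! ### Integrals, the Nakayama automorphism and the order of the squared antipode -/

section Integrals
variable {k : Type u} {A : Type v} [Field k] [Ring A] [HopfAlgebra k A]

/-- The contraction `a ↦ f(a₁) a₂` of the comultiplication with a linear functional `f`. -/
noncomputable def contract (f : A →ₗ[k] k) : A →ₗ[k] A :=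
  (TensorProduct.lid k A).toLinearMap ∘ₗ f.rTensor A ∘ₗ comul

theorem contract_eq_sum (f : A →ₗ[k] k) {a : A} {ι : Type*} (r : Coalgebra.Repr k a ι) :
    contract f a = ∑ i ∈ r.index, f (r.left i) • r.right i := by
  simp only [contract, LinearMap.comp_apply]
  rw [← r.eq]
  simp

theorem contract_one (f : A →ₗ[k] k) : contract f (1 : A) = f 1 • (1 : A) := by
  simp [contract, Algebra.TensorProduct.one_def]

theorem apply_contract (f g : A →ₗ[k] k) (a : A) :
    g (contract f a) = (WithConv.toConv f * WithConv.toConv g : DualAlgebra k A) a := by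
  rw [contract_eq_sum f (ℛ k a), (ℛ k a).convMul_apply]
  simp

theorem eq_of_forall_dual [FiniteDimensional k A] {x y : A} (h : ∀ f : A →ₗ[k] k, f x = f y) :
    x = y :=
  (Module.forall_dual_apply_eq_zero_iff k (x - y)).1 (fun f => by simp [h f]) |> sub_eq_zero.1

theorem tensor_eq_of_forall_dual [FiniteDimensional k A] {x y : A ⊗[k] A}
    (h : ∀ f g : A →ₗ[k] k, LinearMap.mul' k k (TensorProduct.map f g x) =
      LinearMap.mul' k k (TensorProduct.map f g y)) : x = y := by
  let b := Module.finBasis k A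
  refine (b.tensorProduct b).ext_elem fun ⟨i, j⟩ => ?_
  have h2 : ∀ x : A ⊗[k] A, (b.tensorProduct b).repr x (i, j) =
      LinearMap.mul' k k (TensorProduct.map (b.coord i) (b.coord j) x) := by
    intro x
    induction x with
    | zero => simp
    | add x y hx hy => simp only [map_add, Finsupp.add_apply, hx, hy]
    | tmul x y => simp [mul_comm]
  rw [h2, h2, h]

theorem contract_mul [FiniteDimensional k A] (f g : DualAlgebra k A) (a : A) :
    contract (f * g).ofConv a = contract g.ofConv (contract f.ofConv a) := by
  refine eq_of_forall_dual (k := k) fun l => ?_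
  rw [apply_contract, apply_contract]
  have h : ∀ u : DualAlgebra k A, u (contract f.ofConv a) = (f * u) a := fun u =>
    apply_contract f.ofConv u.ofConv a
  change ((f * g) * WithConv.toConv l) a = (g * WithConv.toConv l) (contract f.ofConv a)
  rw [h, mul_assoc]

/-- `Δ(a₁) (1 ⊗ S(a₂)) = a ⊗ 1`. -/
theorem sum_comul_mul_one_tmul_antipode (a : A) :
    ∑ i ∈ (ℛ k a).index, comul ((ℛ k a).left i) *
      ((1 : A) ⊗ₜ[k] (antipode k ((ℛ k a).right i))) = a ⊗ₜ[k] (1 : A) := by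
  have h := sum_tmul_tmul_eq (ℛ k a) (fun i => ℛ k ((ℛ k a).left i))
    (fun i => ℛ k ((ℛ k a).right i))
  let F : A ⊗[k] (A ⊗[k] A) →ₗ[k] A ⊗[k] A :=
    (LinearMap.mul' k A ∘ₗ (antipode k).lTensor A).lTensor A
  have hF := congrArg F h
  have e : ∀ x y z : A, F (x ⊗ₜ (y ⊗ₜ z)) = x ⊗ₜ (y * antipode k z) := fun x y z => by simp [F]
  simp only [map_sum, e] at hF
  calc _ = ∑ i ∈ (ℛ k a).index, ∑ j ∈ (ℛ k ((ℛ k a).left i)).index,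
        ((ℛ k ((ℛ k a).left i)).left j) ⊗ₜ[k]
          ((ℛ k ((ℛ k a).left i)).right j * antipode k ((ℛ k a).right i)) := by
        refine Finset.sum_congr rfl fun i _ => ?_
        rw [← (ℛ k ((ℛ k a).left i)).eq, Finset.sum_mul]
        simp
    _ = _ := by
        rw [hF]
        simp_rw [← TensorProduct.tmul_sum, sum_mul_antipode_eq_smul, ← TensorProduct.smul_tmul,
          ← TensorProduct.sum_tmul]
        congr 1
        have h2 := congrArg (TensorProduct.rid k A) (sum_tmul_counit_eq (R := k) (ℛ k a))
        simpa only [map_sum, TensorProduct.rid_tmul, one_smul] using h2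

/-- A left integral satisfies `t₁ ⊗ a t₂ = S(a) t₁ ⊗ t₂`. -/
theorem one_tmul_mul_comul_of_integral {t : A} (ht : ∀ a : A, a * t = counit (R := k) a • t)
    (a : A) : ((1 : A) ⊗ₜ[k] a) * comul t = (antipode k a ⊗ₜ[k] (1 : A)) * comul t := by
  rw [← sum_antipode_tmul_one_mul_comul, Finset.sum_mul]
  simp_rw [mul_assoc, ← Bialgebra.comul_mul, ht, map_smul, mul_smul_comm, ← smul_mul_assoc,
    ← Finset.sum_mul, TensorProduct.smul_tmul', ← TensorProduct.sum_tmul, ← map_smul, ← map_sum]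
  congr 3
  have h2 := congrArg (TensorProduct.rid k A) (sum_tmul_counit_eq (R := k) (ℛ k a))
  simpa only [map_sum, TensorProduct.rid_tmul, one_smul] using h2

/-- A right integral satisfies `t₁ a ⊗ t₂ = t₁ ⊗ t₂ S(a)`. -/
theorem comul_mul_tmul_one_of_integral {t : A} (ht : ∀ a : A, t * a = counit (R := k) a • t)
    (a : A) : comul t * (a ⊗ₜ[k] (1 : A)) = comul t * ((1 : A) ⊗ₜ[k] antipode k a) := by
  rw [← sum_comul_mul_one_tmul_antipode, Finset.mul_sum]
  simp_rw [← mul_assoc, ← Bialgebra.comul_mul, ht, map_smul, smul_mul_assoc, ← mul_smul_comm,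
    ← Finset.mul_sum, ← TensorProduct.tmul_smul, ← TensorProduct.tmul_sum, ← map_smul, ← map_sum,
    sum_counit_smul]

theorem contract_mulLeft_antipode {t : A} (ht : ∀ a : A, a * t = counit (R := k) a • t)
    (f : A →ₗ[k] k) (a : A) :
    contract (f ∘ₗ LinearMap.mulLeft k (antipode k a)) t = a * contract f t := by
  have h := congrArg (TensorProduct.lid k A ∘ f.rTensor A) (one_tmul_mul_comul_of_integral ht a)
  rw [← (ℛ k t).eq] at h
  rw [contract_eq_sum _ (ℛ k t), contract_eq_sum _ (ℛ k t)]
  simpa [Finset.mul_sum] using h.symm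

theorem contract_mulRight {t : A} (ht : ∀ a : A, t * a = counit (R := k) a • t)
    (f : A →ₗ[k] k) (a : A) :
    contract (f ∘ₗ LinearMap.mulRight k a) t = contract f t * antipode k a := by
  have h := congrArg (TensorProduct.lid k A ∘ f.rTensor A) (comul_mul_tmul_one_of_integral ht a)
  rw [← (ℛ k t).eq] at h
  rw [contract_eq_sum _ (ℛ k t), contract_eq_sum _ (ℛ k t)]
  simpa [Finset.sum_mul] using h

variable (k A) in
/-- A normalized two-sided integral of a Hopf algebra, invariant under the antipode. -/
structure IsHaarIntegral (t : A) : Prop where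
  mul_left : ∀ a : A, a * t = counit (R := k) a • t
  mul_right : ∀ a : A, t * a = counit (R := k) a • t
  counit_eq : counit (R := k) t = 1
  antipode_eq : antipode k t = t

theorem exists_isHaarIntegral [FiniteDimensional k A] [IsSemisimpleRing A] :
    ∃ t : A, IsHaarIntegral k A t := by
  obtain ⟨t, ht, ht1⟩ := exists_integral (k := k) (A := A)
  have hsurj : Function.Surjective (antipode k (A := A)) :=
    LinearMap.surjective_of_injective antipode_injective
  have hS : ∀ a : A, antipode k t * a = counit (R := k) a • antipode k t := by
    intro a
    obtain ⟨b, rfl⟩ := hsurj a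
    rw [← antipode_mul_antidistrib, ht, map_smul, counit_antipode]
  have hSt : antipode k t = t := by
    have h1 := hS t
    rw [ht, ht1, one_smul, counit_antipode, ht1, one_smul] at h1
    exact h1.symm
  exact ⟨t, ht, by rw [hSt] at hS; exact hS, ht1, hSt⟩

variable [FiniteDimensional k A]

/-- The left ideal of all `f(t₁) t₂` contains `S(t₁) t₂ = 1`, so that contraction with `t` is onto,
hence bijective. -/
theorem IsHaarIntegral.contract_bijective {t : A} (ht : IsHaarIntegral k A t) :
    Function.Bijective (fun f : A →ₗ[k] k => contract f t) := by
  let φ : (A →ₗ[k] k) →ₗ[k] A :=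
    { toFun := fun f => contract f t
      map_add' := fun f g => by
        rw [contract_eq_sum _ (ℛ k t), contract_eq_sum _ (ℛ k t), contract_eq_sum _ (ℛ k t)]
        simp [add_smul, Finset.sum_add_distrib]
      map_smul' := fun c f => by
        rw [contract_eq_sum _ (ℛ k t), contract_eq_sum _ (ℛ k t)]
        simp [Finset.smul_sum, smul_smul] }
  have hideal : ∀ a x, x ∈ LinearMap.range φ → a * x ∈ LinearMap.range φ := by
    rintro a _ ⟨f, rfl⟩
    exact ⟨_, contract_mulLeft_antipode ht.mul_left f a⟩
  have hone : (1 : A) ∈ LinearMap.range φ := by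
    have h := sum_antipode_mul_eq_smul (R := k) (ℛ k t)
    rw [ht.counit_eq, one_smul] at h
    let b := Module.finBasis k A
    have e : (1 : A) = ∑ j, antipode k (b j) * φ (b.coord j) := by
      rw [← h]
      have : ∀ j, φ (b.coord j) = ∑ i ∈ (ℛ k t).index,
          b.coord j ((ℛ k t).left i) • (ℛ k t).right i := fun j => contract_eq_sum _ _
      simp_rw [this, Finset.mul_sum]
      rw [Finset.sum_comm]
      refine Finset.sum_congr rfl fun i _ => ?_
      conv_lhs => rw [← b.sum_repr ((ℛ k t).left i)]
      simp only [map_sum, map_smul, Finset.sum_mul, smul_mul_assoc, mul_smul_comm,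
        Module.Basis.coord_apply]
    rw [e]
    exact Submodule.sum_mem _ fun j _ => hideal _ _ ⟨_, rfl⟩
  have hsurj : Function.Surjective φ := fun a => by
    simpa using hideal a 1 hone
  exact ⟨(LinearMap.injective_iff_surjective_of_finrank_eq_finrank
    (Subspace.dual_finrank_eq (K := k) (V := A))).2 hsurj, hsurj⟩

/-- A linear functional `l` with `l(t₁) t₂ = 1`, for a Haar integral `t`. It is a right integral
of the dual algebra and a Frobenius form on `A`. -/
structure IsDualIntegral (t : A) (l : A →ₗ[k] k) : Prop where
  haar : IsHaarIntegral k A t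
  contract_eq : contract l t = 1

theorem exists_isDualIntegral [IsSemisimpleRing A] :
    ∃ (t : A) (l : A →ₗ[k] k), IsDualIntegral t l := by
  obtain ⟨t, ht⟩ := exists_isHaarIntegral (k := k) (A := A)
  obtain ⟨l, hl⟩ := ht.contract_bijective.2 1
  exact ⟨t, l, ht, hl⟩

namespace IsDualIntegral
variable {t : A} {l : A →ₗ[k] k} (h : IsDualIntegral t l)
include h

theorem contract_apply (a : A) : contract l a = l a • (1 : A) := by
  have key : ∀ g : DualAlgebra k A, WithConv.toConv l * g = g 1 • WithConv.toConv l := by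
    intro g
    refine WithConv.ofConv_injective (h.haar.contract_bijective.1 ?_)
    change contract _ t = contract _ t
    rw [contract_mul]
    change contract _ (contract l t) = contract (g 1 • l) t
    rw [h.contract_eq, contract_one]
    have : contract (g 1 • l) t = g 1 • contract l t := by
      rw [contract_eq_sum _ (ℛ k t), contract_eq_sum _ (ℛ k t)]
      simp [Finset.smul_sum, smul_smul]
    rw [this, h.contract_eq]
  refine eq_of_forall_dual (k := k) fun g => ?_
  rw [apply_contract, key, map_smul, smul_eq_mul, mul_comm]
  rfl

theorem apply_haar : l t = 1 := by
  have h1 := h.contract_eq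
  rw [h.contract_apply] at h1
  have h2 := congrArg (counit (R := k)) h1
  simpa using h2

omit [FiniteDimensional k A] in
theorem contract_mulLeft (a : A) :
    contract (l ∘ₗ LinearMap.mulLeft k (antipode k a)) t = a := by
  rw [contract_mulLeft_antipode h.haar.mul_left, h.contract_eq, mul_one]

omit [FiniteDimensional k A] in
theorem contract_mulRight (a : A) :
    contract (l ∘ₗ LinearMap.mulRight k a) t = antipode k a := by
  rw [HopfClifford.contract_mulRight h.haar.mul_right, h.contract_eq, one_mul]

/-- `S²` is the Nakayama automorphism of the Frobenius form `l`. -/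
theorem apply_antipode_antipode_mul (y b : A) :
    l (antipode k (antipode k y) * b) = l (b * y) := by
  have := h.haar.contract_bijective.1
    ((h.contract_mulLeft (antipode k y)).trans (h.contract_mulRight y).symm)
  exact LinearMap.congr_fun this b

theorem apply_antipode_antipode (y : A) : l (antipode k (antipode k y)) = l y := by
  simpa using h.apply_antipode_antipode_mul y 1

/-- Radford's trace formula, from `S²(a) = l(t₁ a) S(t₂)`. -/
theorem trace_antipode_antipode :
    LinearMap.trace k A (antipode k ∘ₗ antipode k) = l 1 := by
  have e : (antipode k ∘ₗ antipode k : A →ₗ[k] A) = ∑ i ∈ (ℛ k t).index,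
      dualTensorHom k A A ((l ∘ₗ LinearMap.mulLeft k ((ℛ k t).left i)) ⊗ₜ
        antipode k ((ℛ k t).right i)) := by
    ext a
    rw [LinearMap.comp_apply, ← h.contract_mulRight a, contract_eq_sum _ (ℛ k t)]
    simp [dualTensorHom_apply]
  rw [e, map_sum]
  simp only [LinearMap.trace_eq_contract_apply, contractLeft_apply, LinearMap.comp_apply,
    LinearMap.mulLeft_apply]
  rw [← map_sum, sum_mul_antipode_eq_smul, h.haar.counit_eq, one_smul]

/-- The distinguished group-like element `t₁ l(t₂)`. -/
theorem exists_distinguished : ∃ g : A, (∀ f : A →ₗ[k] k, f g = l (contract f t)) ∧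
    IsGroupLikeElem k g := by
  let g : A := TensorProduct.rid k A (l.lTensor A (comul t))
  have hg : ∀ f : A →ₗ[k] k, f g = l (contract f t) := by
    intro f
    rw [contract_eq_sum _ (ℛ k t)]
    simp only [g]
    rw [← (ℛ k t).eq]
    simp [mul_comm]
  have hmul : ∀ f : DualAlgebra k A, f * WithConv.toConv l = f g • WithConv.toConv l := by
    intro f
    refine WithConv.ofConv_injective (h.haar.contract_bijective.1 ?_)
    change contract _ t = contract (f g • l) t
    have : contract (f g • l) t = f g • contract l t := by
      rw [contract_eq_sum _ (ℛ k t), contract_eq_sum _ (ℛ k t)]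
      simp [Finset.smul_sum, smul_smul]
    rw [contract_mul, this, h.contract_eq, h.contract_apply, ← hg]
  have hchar : ∀ f f' : DualAlgebra k A, (f * f') g = f g * f' g := by
    intro f f'
    have h1 := hmul (f * f')
    rw [mul_assoc, hmul f', mul_smul_comm, hmul f, smul_smul] at h1
    have h2 := congrArg (fun u : DualAlgebra k A => u t) h1
    have h3 : ∀ c : k, (c • (WithConv.toConv l : DualAlgebra k A)) t = c := fun c => by
      change c * l t = c
      rw [h.apply_haar, mul_one]
    simp only [h3] at h2
    rw [← h2, mul_comm]
  refine ⟨g, hg, ⟨?_, ?_⟩⟩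
  · have h1 := hmul 1
    rw [one_mul] at h1
    have h2 := congrArg (fun u : DualAlgebra k A => u t) h1
    change l t = _ * l t at h2
    rw [h.apply_haar, mul_one] at h2
    simpa using h2.symm
  · refine tensor_eq_of_forall_dual fun f f' => ?_
    have h1 := hchar (WithConv.toConv f) (WithConv.toConv f')
    simpa using h1

/-- Radford's formula for the fourth power of the antipode of a unimodular Hopf algebra. -/
theorem exists_antipode_pow_four : ∃ g : A, IsGroupLikeElem k g ∧
    ∀ a : A, antipode k (antipode k (antipode k (antipode k a))) * g = g * a := by
  obtain ⟨g, hg, hgl⟩ := h.exists_distinguished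
  have hcomm : comul (R := k) t =
      TensorProduct.comm k A A (TensorProduct.map (antipode k) (antipode k) (comul t)) := by
    rw [← comul_antipode_eq, h.haar.antipode_eq]
  -- The antipode of `g = t₁ l(t₂)` is `l(S(t₁)) t₂`, as `S(t) = t` and `l ∘ S² = l`.
  have hSg : contract (l ∘ₗ antipode k) t = antipode k g := by
    refine eq_of_forall_dual (k := k) fun f => ?_
    change _ = (f ∘ₗ antipode k) g
    rw [hg, contract_eq_sum (f ∘ₗ antipode k) (ℛ k t)]
    rw [contract, LinearMap.comp_apply, LinearMap.comp_apply, hcomm, ← (ℛ k t).eq]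
    simp [h.apply_antipode_antipode, mul_comm]
  have hl : l ∘ₗ antipode k = l ∘ₗ LinearMap.mulLeft k g := by
    refine h.haar.contract_bijective.1 ?_
    change contract _ t = contract _ t
    have h1 := h.contract_mulLeft (antipode k g)
    rw [hgl.antipode_antipode] at h1
    rw [hSg, h1]
  have hl' : ∀ a, l (antipode k a) = l (g * a) := fun a => LinearMap.congr_fun hl a
  have hnak : ∀ a b, l (g * (a * b)) = l (g * (b * antipode k (antipode k a))) := by
    intro a b
    rw [← hl', ← hl', antipode_mul_antidistrib, ← h.apply_antipode_antipode_mul,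
      antipode_mul_antidistrib]
  refine ⟨g, hgl, fun a => ?_⟩
  have hS : ∀ x y : A, (∀ b, l (x * b) = l (y * b)) → x = y := by
    intro x y hxy
    have hsurj : Function.Surjective (antipode k (A := A)) := by
      refine LinearMap.surjective_of_injective fun x y hxy => ?_
      rw [← h.contract_mulLeft x, ← h.contract_mulLeft y, hxy]
    obtain ⟨x, rfl⟩ := hsurj x
    obtain ⟨y, rfl⟩ := hsurj y
    have : l ∘ₗ LinearMap.mulLeft k (antipode k x) = l ∘ₗ LinearMap.mulLeft k (antipode k y) :=
      LinearMap.ext hxy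
    rw [← h.contract_mulLeft x, this, h.contract_mulLeft]
  refine hS _ _ fun b => ?_
  rw [mul_assoc, h.apply_antipode_antipode_mul, mul_assoc, mul_assoc, ← hnak]

/-- The square of the antipode has finite order. -/
theorem exists_iterate_antipode : ∃ n : ℕ, 0 < n ∧
    ∀ a : A, (fun x : A => antipode k (antipode k x))^[n] a = a := by
  obtain ⟨g, hg, hS⟩ := h.exists_antipode_pow_four
  have : Finite (GroupLike k A) := (linearIndep_groupLikeVal (R := k) (A := A)).finite
  let γ : GroupLike k A := ⟨g, hg⟩
  obtain ⟨n, hn, hγ⟩ := isOfFinOrder_iff_pow_eq_one.1 (isOfFinOrder_of_finite γ)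
  have hgn : g ^ n = 1 := by
    have := congrArg GroupLike.val hγ
    simpa using this
  refine ⟨2 * n, by positivity, fun a => ?_⟩
  have e : ∀ m : ℕ, (fun x : A => antipode k (antipode k x))^[2 * m] a * g ^ m = g ^ m * a := by
    intro m
    induction m with
    | zero => simp
    | succ m ih =>
      rw [show 2 * (m + 1) = (2 * m).succ.succ from rfl, Function.iterate_succ_apply',
        Function.iterate_succ_apply', pow_succ', ← mul_assoc, hS, mul_assoc, ih, mul_assoc]
  simpa [hgn] using e n

end IsDualIntegral
end Integrals

/-! ### Traces of matrices of finite order -/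

section FiniteOrder
variable {k : Type u} [Field k] [CharZero k]

/-- The spectral decomposition of an element of finite order, by finite Fourier transform. -/
theorem exists_spectral_idempotents {R : Type*} [Ring R] [Algebra k R] {m : ℕ} (hm : 0 < m)
    {ζ : k} (hζ : IsPrimitiveRoot ζ m) {v : R} (hv : v ^ m = 1) :
    ∃ e : ℕ → R, (∀ j, IsIdempotentElem (e j)) ∧
      ∀ s : ℕ, v ^ s = ∑ j ∈ Finset.range m, (ζ ^ (j * s)) • e j := by
  have hζ0 : ζ ≠ 0 := hζ.ne_zero hm.ne'
  have hm0 : (m : k) ≠ 0 := Nat.cast_ne_zero.2 hm.ne'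
  -- `e j` is the average of the powers of `ζ⁻ʲ v`, the projection onto the eigenspace of `ζʲ`.
  let u : ℕ → R := fun j => (ζ⁻¹ ^ j) • v
  let e : ℕ → R := fun j => (m : k)⁻¹ • ∑ s ∈ Finset.range m, u j ^ s
  have hum : ∀ j, u j ^ m = 1 := fun j => by
    simp only [u]
    rw [smul_pow, hv, ← pow_mul, mul_comm, pow_mul, inv_pow, hζ.pow_eq_one]
    simp
  have hue : ∀ j, u j * e j = e j := fun j => by
    simp only [e]
    rw [mul_smul_comm]
    congr 1
    have h := mul_geom_sum (u j) m
    rw [hum, sub_self, sub_mul, one_mul] at h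
    exact sub_eq_zero.1 h
  have hupe : ∀ j s, u j ^ s * e j = e j := fun j s => by
    induction s with
    | zero => simp
    | succ s ih => rw [pow_succ, mul_assoc, hue, ih]
  have hve : ∀ j s, v ^ s * e j = ζ ^ (j * s) • e j := fun j s => by
    have : v = ζ ^ j • u j := by
      simp only [u, smul_smul]
      rw [← mul_pow, mul_inv_cancel₀ hζ0, one_pow, one_smul]
    rw [this, smul_pow, smul_mul_assoc, hupe, ← pow_mul]
  have hsum : ∑ j ∈ Finset.range m, e j = 1 := by
    simp only [e, ← Finset.smul_sum, u]
    rw [Finset.sum_comm]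
    have h1 : ∀ s ∈ Finset.range m, ∑ j ∈ Finset.range m, (ζ⁻¹ ^ j • v) ^ s =
        if s = 0 then (m : k) • (1 : R) else 0 := by
      intro s hs
      have h2 : ∀ j, (ζ⁻¹ ^ j • v) ^ s = ((ζ⁻¹ ^ s) ^ j) • v ^ s := fun j => by
        rw [smul_pow, ← pow_mul, ← pow_mul, mul_comm]
      simp_rw [h2, ← Finset.sum_smul]
      split_ifs with h0
      · subst h0; simp
      · have h3 : ζ⁻¹ ^ s ≠ 1 :=
          hζ.inv.pow_ne_one_of_pos_of_lt h0 (Finset.mem_range.1 hs)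
        have h4 := geom_sum_mul (ζ⁻¹ ^ s) m
        rw [← pow_mul, mul_comm s m, pow_mul, hζ.inv.pow_eq_one, one_pow, sub_self] at h4
        rw [(mul_eq_zero.1 h4).resolve_right (sub_ne_zero.2 h3), zero_smul]
    rw [Finset.sum_congr rfl h1, Finset.sum_ite_eq' (Finset.range m), if_pos (by simpa using hm),
      smul_smul, inv_mul_cancel₀ hm0, one_smul]
  refine ⟨e, fun j => ?_, fun s => ?_⟩
  · change e j * e j = e j
    conv_lhs => enter [1]; simp only [e]
    rw [smul_mul_assoc, Finset.sum_mul]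
    simp_rw [hupe]
    rw [Finset.sum_const, Finset.card_range, ← Nat.cast_smul_eq_nsmul k, smul_smul,
      inv_mul_cancel₀ hm0, one_smul]
  · rw [← mul_one (v ^ s), ← hsum, Finset.mul_sum]
    exact Finset.sum_congr rfl fun j _ => hve j s

omit [CharZero k] in
theorem exists_nat_trace_eq {V : Type*} [AddCommGroup V] [Module k V]
    [FiniteDimensional k V] {e : Module.End k V} (he : IsIdempotentElem e) :
    ∃ r : ℕ, LinearMap.trace k V e = r :=
  ⟨_, (LinearMap.IsIdempotentElem.isProj_range e he).trace⟩

omit [CharZero k] in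
theorem exists_nat_matrix_trace_eq {n : Type*} [Fintype n] [DecidableEq n] {e : Matrix n n k}
    (he : IsIdempotentElem e) : ∃ r : ℕ, e.trace = r := by
  have h : IsIdempotentElem (Matrix.toLin' e) := by
    change _ * _ = _
    rw [Module.End.mul_eq_comp, ← Matrix.toLin'_mul, he.eq]
  obtain ⟨r, hr⟩ := exists_nat_trace_eq h
  exact ⟨r, by rw [← hr, Matrix.trace_toLin'_eq]⟩

/-- The traces of a matrix of finite order and of its inverse are complex conjugate, for any
embedding of the algebraic numbers of `k` into `ℂ`. -/
theorem exists_conj_trace [IsAlgClosed k] (σ : algebraicClosure ℚ k →+* ℂ) {n : Type*}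
    [Fintype n] [DecidableEq n] {m : ℕ} (hm : 0 < m) {v : Matrix n n k} (hv : v ^ m = 1) :
    ∃ z z' : algebraicClosure ℚ k, v.trace = z ∧ (v⁻¹).trace = z' ∧ σ z' = star (σ z) := by
  have : NeZero m := ⟨hm.ne'⟩
  obtain ⟨ζ, hζ⟩ := HasEnoughRootsOfUnity.exists_primitiveRoot k m
  obtain ⟨e, he, hpow⟩ := exists_spectral_idempotents hm hζ hv
  choose r hr using fun j => exists_nat_matrix_trace_eq (he j)
  let ξ : algebraicClosure ℚ k := ⟨ζ, mem_algebraicClosure_iff'.2 (hζ.isIntegral hm).tower_top⟩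
  have htr : ∀ s, (v ^ s).trace =
      ((∑ j ∈ Finset.range m, ξ ^ (j * s) * (r j : algebraicClosure ℚ k) :
        algebraicClosure ℚ k) : k) := by
    intro s
    rw [hpow, Matrix.trace_sum]
    push_cast
    refine Finset.sum_congr rfl fun j _ => ?_
    rw [Matrix.trace_smul, hr, smul_eq_mul]
  have hinv : v⁻¹ = v ^ (m - 1) := by
    refine Matrix.inv_eq_right_inv ?_
    rw [← pow_succ', Nat.sub_add_cancel hm, hv]
  have hξ : ξ ^ m = 1 := Subtype.ext (by simpa using hζ.pow_eq_one)
  have hσξ : σ ξ ^ m = 1 := by rw [← map_pow, hξ, map_one]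
  have hconj : σ ξ ^ (m - 1) = star (σ ξ) := by
    have h1 : ‖σ ξ‖ = 1 := Complex.norm_eq_one_of_pow_eq_one hσξ hm.ne'
    have h2 : σ ξ * star (σ ξ) = 1 := by
      have := Complex.mul_conj' (σ ξ)
      rw [h1] at this
      simpa using this
    have h3 : σ ξ * σ ξ ^ (m - 1) = 1 := by rw [← pow_succ', Nat.sub_add_cancel hm, hσξ]
    have h0 : σ ξ ≠ 0 := fun h => by rw [h, zero_mul] at h2; exact zero_ne_one h2
    exact mul_left_cancel₀ h0 (h3.trans h2.symm)
  refine ⟨_, _, (pow_one v ▸ htr 1 :), by rw [hinv]; exact htr (m - 1), ?_⟩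
  simp only [map_sum, map_mul, map_pow, map_natCast, star_sum, star_mul', star_pow, star_natCast]
  refine Finset.sum_congr rfl fun j _ => ?_
  rw [← hconj, ← pow_mul, mul_comm j (m - 1), pow_mul]
  simp [pow_mul]

/-- After rescaling, each `wᵢ` has finite order without a change of `tr(wᵢ) tr(wᵢ⁻¹)`, and this
product becomes `|tr(wᵢ)|²` in `ℂ`; a vanishing sum of such terms has only zero terms. -/
theorem trace_eq_zero_of_sum_trace_mul_trace_inv [IsAlgClosed k] {ι : Type*} [Fintype ι]
    {n : ι → ℕ} [∀ i, NeZero (n i)]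
    {w : ∀ i, Matrix (Fin (n i)) (Fin (n i)) k} {m : ℕ} (hm : 0 < m)
    (hdet : ∀ i, IsUnit (w i).det)
    (hw : ∀ i, ∃ c : k, w i ^ m = c • 1) (h : ∑ i, (w i).trace * ((w i)⁻¹).trace = 0) (i : ι) :
    (w i).trace = 0 := by
  have halg := algebraicClosure.isAlgebraic ℚ k
  let σ : algebraicClosure ℚ k →+* ℂ :=
    (@IsAlgClosed.lift ℂ _ _ ℚ _ _ (algebraicClosure ℚ k) _ _ _ _ _ _ halg).toRingHom
  have key : ∀ i, ∃ (b : k) (z z' : algebraicClosure ℚ k), (w i).trace = b * z ∧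
      (w i).trace * ((w i)⁻¹).trace = z * z' ∧ σ z' = star (σ z) := by
    intro i
    obtain ⟨c, hc⟩ := hw i
    have hc0 : c ≠ 0 := by
      rintro rfl
      have h1 : (w i ^ m).det = 0 := by rw [hc, zero_smul, Matrix.det_zero]
      rw [Matrix.det_pow] at h1
      exact (hdet i).ne_zero (eq_zero_of_pow_eq_zero h1)
    obtain ⟨b, hb⟩ := IsAlgClosed.exists_pow_nat_eq c hm
    have hb0 : b ≠ 0 := by rintro rfl; exact hc0 (by rw [← hb, zero_pow hm.ne'])
    have hv : (b⁻¹ • w i) ^ m = 1 := by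
      rw [smul_pow, hc, smul_smul, inv_pow, hb, inv_mul_cancel₀ hc0, one_smul]
    obtain ⟨z, z', h1, h2, h3⟩ := exists_conj_trace σ hm hv
    have hinv : (b⁻¹ • w i)⁻¹ = b • (w i)⁻¹ := by
      refine Matrix.inv_eq_right_inv ?_
      rw [smul_mul_smul_comm, inv_mul_cancel₀ hb0, Matrix.mul_nonsing_inv _ (hdet i), one_smul]
    rw [hinv, Matrix.trace_smul, smul_eq_mul] at h2
    rw [Matrix.trace_smul, smul_eq_mul] at h1
    refine ⟨b, z, z', ?_, ?_, h3⟩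
    · rw [← h1, mul_inv_cancel_left₀ hb0]
    · rw [← h1, ← h2, mul_mul_mul_comm, inv_mul_cancel₀ hb0, one_mul]
  choose b z z' h1 h2 h3 using key
  have hsum : ∑ i, z i * z' i = 0 := by
    apply Subtype.ext
    push_cast
    rw [← h]
    exact Finset.sum_congr rfl fun i _ => (h2 i).symm
  have hC := congrArg σ hsum
  simp only [map_sum, map_mul, h3, map_zero] at hC
  have hC2 : ∑ i, Complex.normSq (σ (z i)) = 0 := by
    have : ∀ i, σ (z i) * star (σ (z i)) = (Complex.normSq (σ (z i)) : ℂ) := fun i =>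
      Complex.mul_conj _
    simp only [this] at hC
    exact_mod_cast hC
  have h0 := (Finset.sum_eq_zero_iff_of_nonneg fun i _ => Complex.normSq_nonneg _).1 hC2 i
    (Finset.mem_univ i)
  rw [Complex.normSq_eq_zero, map_eq_zero] at h0
  rw [h1, h0]
  simp

end FiniteOrder

/-! ### Products of matrix algebras -/

section MatrixProduct
variable {k : Type u} [Field k] {ι : Type*} [Fintype ι] [DecidableEq ι] (n : ι → ℕ)

/-- A product of full matrix algebras over `k`. -/
abbrev MatrixProduct (k : Type u) [Field k] (n : ι → ℕ) : Type _ :=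
  ∀ i, Matrix (Fin (n i)) (Fin (n i)) k

variable {n}

/-- The matrix unit `E_{ab}` of the block `i`. -/
def matrixUnit (k : Type u) [Field k] (n : ι → ℕ) (i : ι) (a b : Fin (n i)) :
    MatrixProduct k n :=
  Pi.single i (Matrix.single a b 1)

omit [Fintype ι] in
theorem matrixUnit_mul (i : ι) (a b c d : Fin (n i)) :
    matrixUnit k n i a b * matrixUnit k n i c d =
      if b = c then matrixUnit k n i a d else 0 := by
  rw [matrixUnit, matrixUnit, ← Pi.single_mul]
  split_ifs with h
  · subst h; simp [matrixUnit]
  · simp [h]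

omit [Fintype ι] in
theorem matrixUnit_apply (i j : ι) (a b : Fin (n i)) (c d : Fin (n j)) :
    matrixUnit k n i a b j c d =
      if (⟨i, a, b⟩ : Σ i, Fin (n i) × Fin (n i)) = ⟨j, c, d⟩ then 1 else 0 := by
  by_cases hij : i = j
  · subst hij
    simp [matrixUnit, Matrix.single_apply]
  · rw [if_neg (fun h => hij (congrArg Sigma.fst h)), matrixUnit,
      Pi.single_eq_of_ne (Ne.symm hij)]
    rfl

theorem matrixProduct_eq_sum (x : MatrixProduct k n) :
    x = ∑ i, ∑ a, ∑ b, x i a b • matrixUnit k n i a b := by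
  conv_lhs => rw [← Finset.univ_sum_single x]
  refine Finset.sum_congr rfl fun i _ => ?_
  conv_lhs => rw [Matrix.matrix_eq_sum_single (x i)]
  rw [← LinearMap.single_apply (R := k)]
  simp only [map_sum, matrixUnit]
  refine Finset.sum_congr rfl fun a _ => Finset.sum_congr rfl fun b _ => ?_
  rw [← LinearMap.single_apply (R := k), ← map_smul, Matrix.smul_single, smul_eq_mul, mul_one]

omit [Fintype ι] in
theorem matrixUnit_mul_mul (i : ι) (a b c d : Fin (n i)) (x : MatrixProduct k n) :
    matrixUnit k n i a b * x * matrixUnit k n i c d = x i b c • matrixUnit k n i a d := by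
  funext j
  by_cases hij : i = j
  · subst hij
    simp [matrixUnit, Matrix.single_mul_mul_single]
  · simp [matrixUnit, Pi.single_eq_of_ne (Ne.symm hij)]

/-- Every linear functional on a product of matrix algebras is `x ↦ tr(w x)`. -/
theorem exists_eq_sum_trace (f : MatrixProduct k n →ₗ[k] k) :
    ∃ w : MatrixProduct k n, ∀ x, f x = ∑ i, (w i * x i).trace := by
  refine ⟨fun i a b => f (matrixUnit k n i b a), fun x => ?_⟩
  conv_lhs => rw [matrixProduct_eq_sum x]
  simp only [map_sum, map_smul, smul_eq_mul, Matrix.trace, Matrix.diag_apply]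
  refine Finset.sum_congr rfl fun i _ => ?_
  rw [Finset.sum_comm]
  exact Finset.sum_congr rfl fun a _ => Finset.sum_congr rfl fun b _ => mul_comm _ _

theorem trace_mulLeft_comp_mulRight (a b : MatrixProduct k n) :
    LinearMap.trace k (MatrixProduct k n) (LinearMap.mulLeft k a ∘ₗ LinearMap.mulRight k b) =
      ∑ i, (a i).trace * (b i).trace := by
  let B := Pi.basis (fun i => Matrix.stdBasis k (Fin (n i)) (Fin (n i)))
  have hB : ∀ i p, B ⟨i, p⟩ = matrixUnit k n i p.1 p.2 := fun i p => by
    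
    obtain ⟨p, q⟩ := p
    simp [B, matrixUnit, Matrix.stdBasis_eq_single]
  have hr : ∀ (x : MatrixProduct k n) i p, B.repr x ⟨i, p⟩ = x i p.1 p.2 := fun x i p => by
    simp only [B, Pi.basis_repr]
    rfl
  rw [LinearMap.trace_eq_matrix_trace k B, Matrix.trace, Fintype.sum_sigma]
  refine Finset.sum_congr rfl fun i _ => ?_
  rw [Fintype.sum_prod_type]
  simp only [Matrix.diag_apply, LinearMap.toMatrix_apply, hr, hB, LinearMap.comp_apply,
    LinearMap.mulLeft_apply, LinearMap.mulRight_apply, Pi.mul_apply]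
  simp only [matrixUnit, Pi.single_eq_same, Matrix.trace, Matrix.diag_apply, Finset.sum_mul_sum]
  refine Finset.sum_congr rfl fun p _ => Finset.sum_congr rfl fun q _ => ?_
  simp [Matrix.mul_apply, Matrix.single_apply, ite_and]

end MatrixProduct

/-! ### Semisimple Hopf algebras are cosemisimple -/

section Cosemisimple
variable {k : Type u} {A : Type v} [Field k] [Ring A] [HopfAlgebra k A] [FiniteDimensional k A]

/-- Positivity of `tr(S²)` for a semisimple Hopf algebra in characteristic zero: `S²` is conjugation
by an element `w`, whose components `wᵢ` in the simple blocks may be taken of finite order, so that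
`tr(S²)` is the sum of the `|tr(wᵢ)|²`. These do not all vanish, because `l(t) = 1`, where
`l = tr(w ·)` and `t` is central. -/
theorem IsDualIntegral.apply_one_ne_zero [IsAlgClosed k] [CharZero k] [IsSemisimpleRing A]
    {t : A} {l : A →ₗ[k] k} (h : IsDualIntegral t l) : l 1 ≠ 0 := by
  intro hl
  obtain ⟨r, n, hn, ⟨E⟩⟩ := IsSemisimpleRing.exists_algEquiv_pi_matrix_of_isAlgClosed k A
  obtain ⟨w, hw⟩ := exists_eq_sum_trace (l ∘ₗ E.symm.toLinearMap)
  have hw' : ∀ a : A, l a = ∑ i, (w i * E a i).trace := fun a => by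
    rw [← hw]; simp
  have hcomm : ∀ x y : MatrixProduct k n,
      ∑ i, (w i * (x i * y i)).trace = ∑ i, ((y * w) i * x i).trace := by
    intro x y
    refine Finset.sum_congr rfl fun i _ => ?_
    rw [← mul_assoc, Matrix.trace_mul_comm, ← mul_assoc]
    rfl
  let T : A →ₗ[k] A := antipode k ∘ₗ antipode k
  -- `l(S²(y) b) = l(b y)` reads `tr(w S²(y) b) = tr(y w b)`.
  have hT : ∀ y : A, w * E (T y) = E y * w := by
    intro y
    have h1 : ∀ b : MatrixProduct k n, ∑ i, ((w * E (T y)) i * b i).trace =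
        ∑ i, ((E y * w) i * b i).trace := by
      intro b
      have h2 := h.apply_antipode_antipode_mul y (E.symm b)
      rw [hw', hw', map_mul, map_mul, AlgEquiv.apply_symm_apply] at h2
      rw [← hcomm]
      simpa [mul_assoc, T] using h2
    funext i
    refine Matrix.ext_iff_trace_mul_right.2 fun b => ?_
    have h3 := h1 (Pi.single i b)
    rw [Finset.sum_eq_single i, Finset.sum_eq_single i] at h3
    · simpa using h3
    · intro j _ hj; simp [Pi.single_eq_of_ne hj]
    · simp
    · intro j _ hj; simp [Pi.single_eq_of_ne hj]
    · simp
  -- `w` is regular, hence a unit, because the form `l` is nondegenerate.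
  have hreg : ∀ x : MatrixProduct k n, x * w = 0 → x = 0 := by
    intro x hx
    have h1 : l ∘ₗ LinearMap.mulRight k (E.symm x) = l ∘ₗ LinearMap.mulRight k 0 := by
      ext b
      simp only [LinearMap.comp_apply, LinearMap.mulRight_apply, mul_zero, map_zero]
      rw [hw', map_mul, AlgEquiv.apply_symm_apply]
      simp only [Pi.mul_apply]
      rw [hcomm, hx]
      simp
    have h2 := h.contract_mulRight (E.symm x)
    rw [h1, h.contract_mulRight, map_zero] at h2
    have := antipode_injective (k := k) (h2.symm.trans (map_zero (antipode k (A := A))).symm)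
    simpa using this
  obtain ⟨w', hw1⟩ : ∃ w' : MatrixProduct k n, w' * w = 1 := by
    have hinj : Function.Injective (LinearMap.mulRight k w) :=
      (injective_iff_map_eq_zero _).2 hreg
    exact LinearMap.surjective_of_injective hinj 1
  have hw2 : w * w' = 1 := by
    refine sub_eq_zero.1 (hreg _ ?_)
    rw [sub_mul, mul_assoc, hw1, mul_one, one_mul, sub_self]
  have hinv : ∀ i, (w i)⁻¹ = w' i := fun i => Matrix.inv_eq_right_inv (congrFun hw2 i)
  have hdet : ∀ i, IsUnit (w i).det := fun i =>
    (Matrix.isUnit_iff_isUnit_det _).1 (IsUnit.of_mul_eq_one _ (congrFun hw2 i))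
  have htrace : ∑ i, (w i).trace * ((w i)⁻¹).trace = 0 := by
    have h1 : (E.toLinearEquiv.conj T : Module.End k (MatrixProduct k n)) =
        LinearMap.mulLeft k w' ∘ₗ LinearMap.mulRight k w := by
      refine LinearMap.ext fun x => ?_
      obtain ⟨y, rfl⟩ := E.surjective x
      have : w' * (E y * w) = E (T y) := by rw [← hT, ← mul_assoc, hw1, one_mul]
      simp [LinearEquiv.conj_apply, this]
    have h2 := trace_mulLeft_comp_mulRight w' w
    rw [← h1, LinearMap.trace_conj', h.trace_antipode_antipode, hl] at h2
    rw [h2]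
    exact Finset.sum_congr rfl fun i _ => by rw [hinv, mul_comm]
  -- As `S²` has finite order `m`, the power `w ^ m` is central.
  obtain ⟨m, hm, hiter⟩ := h.exists_iterate_antipode
  have hpow : ∀ y : A, w ^ m * E y = E y * w ^ m := by
    have h1 : ∀ j : ℕ, ∀ y : A, w ^ j * E (T^[j] y) = E y * w ^ j := by
      intro j
      induction j with
      | zero => simp
      | succ j ih =>
        intro y
        rw [Function.iterate_succ_apply, pow_succ', mul_assoc, ih, ← mul_assoc, hT, mul_assoc]
    intro y
    conv_lhs => rw [← hiter y]
    exact h1 m y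
  have hscalar : ∀ i, ∃ c : k, w i ^ m = c • 1 := by
    intro i
    have hc : ∀ x : Matrix (Fin (n i)) (Fin (n i)) k, Commute x (w i ^ m) := by
      intro x
      have h1 := congrFun (hpow (E.symm (Pi.single i x))) i
      simp only [AlgEquiv.apply_symm_apply, Pi.mul_apply, Pi.pow_apply, Pi.single_eq_same] at h1
      exact h1.symm
    obtain ⟨c, hc⟩ := Matrix.mem_range_scalar_of_commute_single (M := w i ^ m)
      fun a b _ => hc _
    exact ⟨c, by rw [← hc]; simp [Matrix.smul_one_eq_diagonal]⟩
  have hzero := trace_eq_zero_of_sum_trace_mul_trace_inv hm hdet hscalar htrace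
  -- The central element `E t` is scalar in each block.
  have ht0 : l t = 0 := by
    rw [hw']
    refine Finset.sum_eq_zero fun i _ => ?_
    have hc : ∀ x : Matrix (Fin (n i)) (Fin (n i)) k, Commute x (E t i) := by
      intro x
      have h1 := congrFun (congrArg E ((h.haar.mul_left (E.symm (Pi.single i x))).trans
        (h.haar.mul_right _).symm)) i
      simp only [map_mul, AlgEquiv.apply_symm_apply, Pi.mul_apply, Pi.single_eq_same] at h1
      exact h1
    obtain ⟨c, hc⟩ := Matrix.mem_range_scalar_of_commute_single (M := E t i)
      fun a b _ => hc _
    rw [← hc]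
    simpa [Matrix.trace, Finset.sum_mul] using congrArg (· * c) (hzero i)
  rw [h.apply_haar] at ht0
  exact one_ne_zero ht0

/-- `a₁ l(S(a₂) b) = l(S(a) b₁) b₂`, which makes `(a, b) ↦ l(S(a) b)` a Casimir element of the dual
algebra. -/
theorem IsDualIntegral.sum_smul_apply_antipode_mul {t : A} {l : A →ₗ[k] k}
    (h : IsDualIntegral t l) (a b : A) :
    ∑ i ∈ (ℛ k a).index, l (antipode k ((ℛ k a).right i) * b) • (ℛ k a).left i =
      contract (l ∘ₗ LinearMap.mulLeft k (antipode k a)) b := by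
  -- `a₁ l(S(a₂) b) = a₁ l(S(a₂)₁ b₁) S(a₂)₂ b₂ = a₁ S(a₂) l(S(a₃) b₁) b₂`
  let G : A ⊗[k] A →ₗ[k] A := TensorProduct.lid k A ∘ₗ l.rTensor A
  have hG : ∀ x : A, l x • (1 : A) = G (comul x) := fun x => (h.contract_apply x).symm
  let K : A ⊗[k] A →ₗ[k] A := G ∘ₗ LinearMap.mulRight k (comul b)
  have hs := sum_tmul_tmul_eq (ℛ k a) (fun i => ℛ k ((ℛ k a).left i))
    (fun i => ℛ k ((ℛ k a).right i))
  let F : A ⊗[k] (A ⊗[k] A) →ₗ[k] A :=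
    LinearMap.mul' k A ∘ₗ (K ∘ₗ (TensorProduct.comm k A A).toLinearMap ∘ₗ
      TensorProduct.map (antipode k) (antipode k)).lTensor A
  have hF := congrArg F hs
  have e : ∀ x y z : A, F (x ⊗ₜ (y ⊗ₜ z)) = x * K (antipode k z ⊗ₜ antipode k y) :=
    fun x y z => by simp [F]
  simp only [map_sum, e] at hF
  have hK : ∀ x y : A, K (x ⊗ₜ y) = y * contract (l ∘ₗ LinearMap.mulLeft k x) b := by
    intro x y
    simp only [K, G, LinearMap.comp_apply, LinearMap.mulRight_apply,
      contract_eq_sum _ (ℛ k b)]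
    rw [← (ℛ k b).eq]
    simp [Finset.mul_sum]
  have hleft : ∀ i, l (antipode k ((ℛ k a).right i) * b) • (ℛ k a).left i =
      ∑ j ∈ (ℛ k ((ℛ k a).right i)).index, (ℛ k a).left i *
        K (antipode k ((ℛ k ((ℛ k a).right i)).right j) ⊗ₜ
          antipode k ((ℛ k ((ℛ k a).right i)).left j)) := by
    intro i
    rw [← Finset.mul_sum, ← map_sum]
    conv_lhs => rw [← mul_one ((ℛ k a).left i), ← mul_smul_comm, hG, Bialgebra.comul_mul,
      comul_antipode_eq]
    congr 1
    simp only [K, LinearMap.comp_apply, LinearMap.mulRight_apply]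
    conv_lhs => rw [← (ℛ k ((ℛ k a).right i)).eq]
    simp
  simp_rw [hleft]
  rw [← hF]
  simp_rw [hK, ← mul_assoc, ← Finset.sum_mul, sum_mul_antipode_eq_smul, smul_one_mul]
  have hlin : ∀ x : A, contract (l ∘ₗ LinearMap.mulLeft k (antipode k x)) b =
      K (antipode k x ⊗ₜ 1) := fun x => by rw [hK, one_mul]
  simp_rw [hlin, ← map_smul, TensorProduct.smul_tmul', ← map_smul, ← map_sum,
    ← TensorProduct.sum_tmul, ← map_sum, sum_counit_smul]

/-- A finite-dimensional semisimple Hopf algebra over an algebraically closed field of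
characteristic zero is cosemisimple (Larson and Radford). -/
theorem isSemisimpleRing_dualAlgebra [IsAlgClosed k] [CharZero k] [IsSemisimpleRing A] :
    IsSemisimpleRing (DualAlgebra k A) := by
  obtain ⟨t, l, h⟩ := exists_isDualIntegral (k := k) (A := A)
  have hl := h.apply_one_ne_zero
  let b := Module.finBasis k A
  let x : Fin (Module.finrank k A) → DualAlgebra k A := fun i => WithConv.toConv (b.coord i)
  let y : A →ₗ[k] DualAlgebra k A :=
    { toFun := fun a => WithConv.toConv ((l 1)⁻¹ • (l ∘ₗ LinearMap.mulLeft k (antipode k a)))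
      map_add' := fun a a' => by ext c; simp [add_mul, mul_add]
      map_smul' := fun r a => by ext c; simp [mul_left_comm] }
  have hexp : ∀ f : DualAlgebra k A, f = ∑ i, f (b i) • x i := dual_expansion k A
  have hy : ∀ a c, y a c = (l 1)⁻¹ * l (antipode k a * c) := fun _ _ => rfl
  have hsum : ∀ a c, ∑ i, b.coord i a * y (b i) c = y a c := fun a c => by
    conv_rhs => rw [← b.sum_repr a, map_sum]
    simp [-Module.Basis.sum_repr]
  have hone : ∑ i, x i * y (b i) = 1 := by
    ext a
    simp only [WithConv.ofConv_sum, LinearMap.sum_apply, (ℛ k a).convMul_apply]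
    rw [Finset.sum_comm]
    have h1 : ∀ j, ∑ i, x i ((ℛ k a).left j) * y (b i) ((ℛ k a).right j) =
        y ((ℛ k a).left j) ((ℛ k a).right j) := fun j => hsum _ _
    simp_rw [h1, hy, ← Finset.mul_sum, ← map_sum, sum_antipode_mul_eq_smul, map_smul]
    rw [smul_eq_mul, mul_comm, mul_assoc, mul_inv_cancel₀ hl, mul_one]
    simp
  have hcas : ∀ (f : DualAlgebra k A) (j), ∑ i, (f * x i) (b j) • y (b i) = y (b j) * f := by
    intro f j
    ext c
    have h1 := apply_contract (l ∘ₗ LinearMap.mulLeft k (antipode k (b j))) f.ofConv c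
    rw [← h.sum_smul_apply_antipode_mul] at h1
    have h2 : y (b j) * f = (l 1)⁻¹ • (WithConv.toConv
        (l ∘ₗ LinearMap.mulLeft k (antipode k (b j))) * f : DualAlgebra k A) := by
      rw [← smul_mul_assoc]
      rfl
    rw [h2]
    change _ = (l 1)⁻¹ * (WithConv.toConv
        (l ∘ₗ LinearMap.mulLeft k (antipode k (b j))) * f : DualAlgebra k A) c
    rw [WithConv.toConv_ofConv] at h1
    rw [← h1]
    simp only [WithConv.ofConv_sum, LinearMap.sum_apply, WithConv.ofConv_smul,
      LinearMap.smul_apply, (ℛ k (b j)).convMul_apply, smul_eq_mul, Finset.sum_mul, map_sum,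
      map_smul, Finset.mul_sum]
    rw [Finset.sum_comm]
    refine Finset.sum_congr rfl fun i _ => ?_
    have h3 := hsum ((ℛ k (b j)).right i) c
    rw [hy] at h3
    rw [← mul_assoc, ← h3, Finset.sum_mul]
    exact Finset.sum_congr rfl fun m _ => by
      rw [mul_assoc, mul_comm]
  -- Averaging a `k`-linear projection onto a left ideal over the Casimir element.
  have hcompl : ∀ I : Submodule (DualAlgebra k A) (DualAlgebra k A), ∃ J, IsCompl I J := by
    intro I
    let s : I →ₗ[k] DualAlgebra k A := I.subtype.restrictScalars k
    obtain ⟨p, hp⟩ := LinearMap.exists_leftInverse_of_injective (K := k) (V := I)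
      (V' := DualAlgebra k A) s (LinearMap.ker_eq_bot.2 Subtype.val_injective)
    have hp' : ∀ z (hz : z ∈ I), (p z : DualAlgebra k A) = z := fun z hz =>
      congrArg Subtype.val (LinearMap.congr_fun hp ⟨z, hz⟩)
    let q : DualAlgebra k A →ₗ[DualAlgebra k A] DualAlgebra k A :=
      { toFun := fun z => ∑ i, x i * (p (y (b i) * z) : DualAlgebra k A)
        map_add' := fun z z' => by simp [mul_add, Finset.sum_add_distrib]
        map_smul' := fun f z => by
          simp only [smul_eq_mul, RingHom.id_apply, Finset.mul_sum]
          have h1 : ∀ j, x j * (p (y (b j) * (f * z)) : DualAlgebra k A) =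
              ∑ i, (f * x i) (b j) • (x j * (p (y (b i) * z) : DualAlgebra k A)) := by
            intro j
            rw [← mul_assoc, ← hcas, Finset.sum_mul, map_sum]
            simp only [smul_mul_assoc, map_smul, Submodule.coe_sum, Finset.mul_sum]
            exact Finset.sum_congr rfl fun i _ => mul_smul_comm _ _ _
          simp_rw [h1]
          rw [Finset.sum_comm]
          refine Finset.sum_congr rfl fun i _ => ?_
          rw [← mul_assoc]
          conv_rhs => rw [hexp (f * x i)]
          rw [Finset.sum_mul]
          simp only [smul_mul_assoc] }
    have hq : ∀ z, q z ∈ I := fun z => by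
      change ∑ i, x i • (p (y (b i) * z) : DualAlgebra k A) ∈ I
      exact Submodule.sum_mem _ fun i _ => I.smul_mem (x i) (p (y (b i) * z)).2
    refine ⟨_, LinearMap.isCompl_of_proj (f := q.codRestrict I hq) fun z => ?_⟩
    apply Subtype.ext
    change ∑ i, x i * (p (y (b i) * z) : DualAlgebra k A) = z
    have h1 : ∀ i, (p (y (b i) * z) : DualAlgebra k A) = y (b i) * z := fun i =>
      hp' _ (I.smul_mem (y (b i)) z.2)
    simp_rw [h1, ← mul_assoc]
    rw [← Finset.sum_mul, hone, one_mul]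
  have : ComplementedLattice (Submodule (DualAlgebra k A) (DualAlgebra k A)) := ⟨hcompl⟩
  exact { this with }
end Cosemisimple

/-! ### Characters of finite-dimensional algebras -/

section TraceFunctionals
variable {k : Type u} [Field k] {ι : Type} [Fintype ι] [DecidableEq ι] {n : ι → ℕ}
  [∀ i, NeZero (n i)]

/-- A linear functional on a product of matrix algebras with `τ(xy) = τ(yx)` is a combination of
the traces of the blocks. -/
theorem eq_sum_of_trace_property (τ : MatrixProduct k n →ₗ[k] k)
    (hτ : ∀ x y, τ (x * y) = τ (y * x)) (x : MatrixProduct k n) :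
    τ x = ∑ i, τ (matrixUnit k n i 0 0) * (x i).trace := by
  obtain ⟨c, hc⟩ : ∃ c : ι → k, ∀ i, τ (matrixUnit k n i 0 0) = c i := ⟨_, fun _ => rfl⟩
  simp_rw [hc]
  have h1 : ∀ i a b, τ (matrixUnit k n i a b) = if a = b then c i else 0 := by
    intro i a b
    rw [← hc]
    have h2 := hτ (matrixUnit k n i a 0) (matrixUnit k n i 0 b)
    rw [matrixUnit_mul, matrixUnit_mul, if_pos rfl] at h2
    rw [h2]
    by_cases hab : a = b
    · simp [hab]
    · simp [hab, Ne.symm hab]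
  conv_lhs => rw [matrixProduct_eq_sum x]
  simp [h1, Matrix.trace, Finset.mul_sum, mul_comm]

variable {R : Type w} [Ring R] [Algebra k R]

/-- A presentation of the largest semisimple quotient of the algebra `R` as a product of matrix
algebras: the kernel of `π` is nil and lies in the Jacobson radical. -/
structure IsMatrixQuotient (π : R →ₐ[k] MatrixProduct k n) : Prop where
  surjective : Function.Surjective π
  isNilpotent : ∀ r, π r = 0 → IsNilpotent r
  mem_jacobson : ∀ r, π r = 0 → r ∈ Ring.jacobson R

variable (k R) in
theorem exists_isMatrixQuotient [IsAlgClosed k] [FiniteDimensional k R] :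
    ∃ (m : ℕ) (n : Fin m → ℕ) (_ : ∀ i, NeZero (n i)) (π : R →ₐ[k] MatrixProduct k n),
      IsMatrixQuotient π := by
  have : IsArtinianRing R := IsArtinianRing.of_finite k R
  obtain ⟨m, n, hn, ⟨E⟩⟩ :=
    IsSemisimpleRing.exists_algEquiv_pi_matrix_of_isAlgClosed k (R ⧸ Ring.jacobson R)
  have hker : ∀ r, (E.toAlgHom.comp (Ideal.Quotient.mkₐ k (Ring.jacobson R))) r = 0 →
      r ∈ Ring.jacobson R := by
    intro r hr
    have h1 : E (Ideal.Quotient.mk _ r) = 0 := hr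
    rw [map_eq_zero_iff _ E.injective] at h1
    exact Ideal.Quotient.eq_zero_iff_mem.1 h1
  refine ⟨m, n, hn, E.toAlgHom.comp (Ideal.Quotient.mkₐ k (Ring.jacobson R)),
    E.surjective.comp (Ideal.Quotient.mkₐ_surjective k _), fun r hr => ?_, hker⟩
  obtain ⟨N, hN⟩ := IsSemiprimaryRing.isNilpotent (R := R)
  exact ⟨N, by
    have := Ideal.pow_mem_pow (hker r hr) N
    rw [hN] at this
    simpa using this⟩

namespace IsMatrixQuotient
variable {π : R →ₐ[k] MatrixProduct k n} (hπ : IsMatrixQuotient π)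
include hπ

omit [Fintype ι] in
/-- Lifts of the primitive idempotents of the simple blocks. -/
theorem exists_lift_idempotent : ∃ x : ι → R, (∀ i, IsIdempotentElem (x i)) ∧
    ∀ i, π (x i) = matrixUnit k n i 0 0 := by
  have h : ∀ i, ∃ e : R, IsIdempotentElem e ∧ π e = matrixUnit k n i 0 0 := fun i =>
    exists_isIdempotentElem_eq_of_ker_isNilpotent (π : R →+* MatrixProduct k n)
      (fun r hr => hπ.isNilpotent r hr) _ (hπ.surjective _) (by
        change _ * _ = _
        rw [matrixUnit_mul, if_pos rfl])
  choose x hx using h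
  exact ⟨x, fun i => (hx i).1, fun i => (hx i).2⟩

theorem apply_eq_sum {τ : R →ₗ[k] k} (hτ : ∀ r s, τ (r * s) = τ (s * r))
    (hker : ∀ r, π r = 0 → τ r = 0) {x : ι → R} (hx : ∀ i, π (x i) = matrixUnit k n i 0 0)
    (r : R) : τ r = ∑ i, τ (x i) * (π r i).trace := by
  obtain ⟨s, hs⟩ := π.toLinearMap.exists_rightInverse_of_surjective
    (LinearMap.range_eq_top.2 hπ.surjective)
  have hs' : ∀ y, π (s y) = y := fun y => LinearMap.congr_fun hs y
  have hτs : ∀ r y, π r = y → τ (s y) = τ r := fun r y h => by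
    rw [← sub_eq_zero, ← map_sub]
    exact hker _ (by rw [map_sub, hs', h, sub_self])
  have h1 := eq_sum_of_trace_property (τ ∘ₗ s) (fun y z => by
    rw [LinearMap.comp_apply, LinearMap.comp_apply, hτs (s y * s z) _ (by simp [hs']),
      hτs (s z * s y) _ (by simp [hs']), hτ]) (π r)
  rw [LinearMap.comp_apply, hτs r _ rfl] at h1
  rw [h1]
  refine Finset.sum_congr rfl fun i _ => ?_
  rw [LinearMap.comp_apply, hτs (x i) _ (hx i)]

variable {V : Type*} [AddCommGroup V] [Module k V] [FiniteDimensional k V]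

omit [FiniteDimensional k V] in
theorem trace_eq_sum (ρ : R →ₐ[k] Module.End k V) {x : ι → R}
    (hx : ∀ i, π (x i) = matrixUnit k n i 0 0) (r : R) :
    LinearMap.trace k V (ρ r) = ∑ i, LinearMap.trace k V (ρ (x i)) * (π r i).trace := by
  refine hπ.apply_eq_sum (τ := LinearMap.trace k V ∘ₗ ρ.toLinearMap) (fun r s => ?_)
    (fun r hr => ?_) hx r
  · simp [LinearMap.trace_mul_comm k (ρ r)]
  · exact (LinearMap.isNilpotent_trace_of_isNilpotent ((hπ.isNilpotent r hr).map ρ)).eq_zero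

/-- An irreducible representation with trivial action of the radical has the character of one of the
simple blocks. -/
theorem exists_trace_eq_of_irreducible [Nontrivial V] (ρ : R →ₐ[k] Module.End k V)
    (hker : ∀ r, π r = 0 → ρ r = 0) (hirr : ∀ v : V, v ≠ 0 → ∀ w, ∃ r, ρ r v = w) :
    ∃ i, ∀ r, LinearMap.trace k V (ρ r) = (π r i).trace := by
  choose L hL using hπ.surjective
  have hρ : ∀ r s, π r = π s → ρ r = ρ s := fun r s h => by
    rw [← sub_eq_zero, ← map_sub]
    exact hker _ (by rw [map_sub, h, sub_self])
  let e := fun (i : ι) (a b : Fin (n i)) => L (matrixUnit k n i a b)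
  have he : ∀ i a b, π (e i a b) = matrixUnit k n i a b := fun i a b => hL _
  obtain ⟨v₀, hv₀⟩ := exists_ne (0 : V)
  obtain ⟨i, a, hia⟩ : ∃ i a, ρ (e i a a) v₀ ≠ 0 := by
    by_contra! hcon
    have h1 : ρ (∑ i, ∑ a, e i a a) = ρ 1 := hρ _ _ (by
      simp only [map_sum, he, map_one]
      rw [matrixProduct_eq_sum (1 : MatrixProduct k n)]
      simp [Matrix.one_apply])
    apply hv₀
    have h2 := LinearMap.congr_fun h1 v₀
    simpa [hcon] using h2.symm
  -- A vector fixed by a primitive idempotent of block `i`. It generates `V`, so the primitive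
  -- idempotents of the other blocks act as zero, and that of block `i` as a projection onto `k v`.
  let v := ρ (e i 0 a) v₀
  have hv : v ≠ 0 := by
    intro h
    have h1 : ρ (e i a 0 * e i 0 a) = ρ (e i a a) := hρ _ _ (by
      simp only [map_mul, he, matrixUnit_mul, if_pos])
    apply hia
    rw [← h1, map_mul, Module.End.mul_apply]
    change ρ _ v = 0
    rw [h, map_zero]
  have hev : ρ (e i 0 0) v = v := by
    have h1 : ρ (e i 0 0 * e i 0 a) = ρ (e i 0 a) := hρ _ _ (by
      simp only [map_mul, he, matrixUnit_mul, if_pos])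
    rw [map_mul] at h1
    exact LinearMap.congr_fun h1 v₀
  have hother : ∀ j, j ≠ i → ρ (e j 0 0) = 0 := by
    intro j hj
    ext w
    obtain ⟨r, rfl⟩ := hirr v hv w
    rw [← hev, ← Module.End.mul_apply, ← Module.End.mul_apply, ← map_mul, ← map_mul,
      hρ (e j 0 0 * r * e i 0 0) 0, map_zero]
    · rfl
    · rw [map_mul, map_mul, he, he, map_zero]
      funext l
      by_cases hl : l = i
      · subst hl
        simp [matrixUnit, Pi.single_eq_of_ne (Ne.symm hj)]
      · simp [matrixUnit, Pi.single_eq_of_ne hl]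
  have hself : LinearMap.trace k V (ρ (e i 0 0)) = 1 := by
    have hproj : LinearMap.IsProj (k ∙ v) (ρ (e i 0 0)) := by
      refine ⟨fun w => ?_, fun w hw => ?_⟩
      · obtain ⟨r, rfl⟩ := hirr v hv w
        have h1 : ρ (e i 0 0 * r * e i 0 0) = ρ (π r i 0 0 • e i 0 0) := hρ _ _ (by
          rw [map_mul, map_mul, he, matrixUnit_mul_mul, map_smul, he])
        have h2 := LinearMap.congr_fun h1 v
        rw [map_mul, map_mul, Module.End.mul_apply, Module.End.mul_apply, hev, map_smul,
          LinearMap.smul_apply, hev] at h2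
        rw [h2]
        exact Submodule.smul_mem _ _ (Submodule.mem_span_singleton_self v)
      · obtain ⟨c, rfl⟩ := Submodule.mem_span_singleton.1 hw
        rw [map_smul, hev]
    rw [hproj.trace, finrank_span_singleton hv, Nat.cast_one]
  refine ⟨i, fun r => ?_⟩
  rw [hπ.trace_eq_sum ρ (x := fun i => e i 0 0) (fun i => he i 0 0),
    Finset.sum_eq_single i (fun j _ hj => by rw [hother j hj, map_zero, zero_mul]) (by simp),
    hself, one_mul]

theorem exists_trace_eq_of_isIrreducibleCharacter {χ : R →ₗ[k] k} (hχ : IsIrreducibleCharacter χ) :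
    ∃ i, ∀ r, χ r = (π r i).trace := by
  obtain ⟨V, _, _, _, _, _, hV, rfl⟩ := hχ
  have := hV.nontrivial
  refine hπ.exists_trace_eq_of_irreducible (Algebra.lsmul k k V : R →ₐ[k] Module.End k V)
    (fun r hr => ?_) (fun v hv w => ?_)
  · ext v
    exact Module.mem_annihilator.1
      (IsSemisimpleModule.jacobson_le_annihilator R V (hπ.mem_jacobson r hr)) v
  · obtain ⟨r, hr⟩ := IsSimpleModule.toSpanSingleton_surjective R hv w
    exact ⟨r, hr⟩

end IsMatrixQuotient

omit [Fintype ι] [DecidableEq ι] [∀ i, NeZero (n i)] in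
theorem isMatrixQuotient_of_algEquiv (E : R ≃ₐ[k] MatrixProduct k n) :
    IsMatrixQuotient (E : R →ₐ[k] MatrixProduct k n) where
  surjective := E.surjective
  isNilpotent r hr := by
    rw [show r = 0 from (map_eq_zero_iff _ E.injective).1 hr]
    exact IsNilpotent.zero
  mem_jacobson r hr := by
    rw [show r = 0 from (map_eq_zero_iff _ E.injective).1 hr]
    exact Submodule.zero_mem _

/-- Each simple block of a semisimple algebra affords an irreducible character, on the minimal left
ideal generated by a primitive idempotent. -/
theorem isIrreducibleCharacter_trace [CharZero k] [FiniteDimensional k R]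
    (E : R ≃ₐ[k] MatrixProduct k n) (i : ι) :
    IsIrreducibleCharacter (Matrix.traceLinearMap (Fin (n i)) k k ∘ₗ LinearMap.proj i ∘ₗ
      E.toLinearMap) := by
  let e := E.symm (matrixUnit k n i 0 0)
  have he : E e = matrixUnit k n i 0 0 := E.apply_symm_apply _
  have hne : e ≠ 0 := by
    intro h
    rw [h, map_zero] at he
    have h1 := congrFun (congrFun (congrFun he i) 0) 0
    simp [matrixUnit] at h1
  have hee : e * e = e := E.injective (by rw [map_mul, he, matrixUnit_mul, if_pos rfl])
  let V : Submodule R R := Submodule.span R {e}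
  have hfin : FiniteDimensional k V :=
    Module.Finite.of_injective (V.subtype.restrictScalars k) Subtype.val_injective
  have heV : e ∈ V := Submodule.mem_span_singleton_self e
  have hsimple : IsSimpleModule R V := by
    rw [isSimpleModule_iff_toSpanSingleton_surjective]
    refine ⟨⟨⟨⟨e, heV⟩, 0, fun h => hne (congrArg Subtype.val h)⟩⟩, ?_⟩
    rintro ⟨x, hx⟩ hx0 ⟨y, hy⟩
    obtain ⟨f, rfl⟩ := Submodule.mem_span_singleton.1 hx
    obtain ⟨g, rfl⟩ := Submodule.mem_span_singleton.1 hy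
    simp only [smul_eq_mul] at *
    obtain ⟨a, ha⟩ : ∃ a, E f i a 0 ≠ 0 := by
      by_contra! hcon
      apply hx0
      apply Subtype.ext
      apply E.injective
      simp only [map_mul, he, ZeroMemClass.coe_zero, map_zero]
      funext l
      by_cases hl : l = i
      · subst hl
        ext p q
        simp only [matrixUnit, Pi.mul_apply, Pi.single_eq_same, Matrix.mul_apply,
          Matrix.single_apply, mul_ite, mul_one, mul_zero]
        refine Finset.sum_eq_zero fun j _ => ?_
        split_ifs with h
        · rw [← h.1]; exact hcon p
        · rfl
      · simp [matrixUnit, Pi.single_eq_of_ne hl]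
    refine ⟨(E f i a 0)⁻¹ • (g * E.symm (matrixUnit k n i 0 a)), Subtype.ext (E.injective ?_)⟩
    have h1 := matrixUnit_mul_mul i 0 a 0 0 (E f)
    simp only [LinearMap.toSpanSingleton_apply, SetLike.mk_smul_mk, smul_eq_mul, map_mul, map_smul,
      he, AlgEquiv.apply_symm_apply, smul_mul_assoc]
    rw [mul_assoc, ← mul_assoc (matrixUnit k n i 0 a), h1, mul_smul_comm, smul_smul,
      inv_mul_cancel₀ ha, one_smul]
  have hirr : IsIrreducibleCharacter (moduleCharacter k V : R →ₗ[k] k) :=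
    ⟨V, inferInstance, inferInstance, inferInstance, inferInstance, hfin, hsimple, rfl⟩
  obtain ⟨j, hj⟩ :=
    (isMatrixQuotient_of_algEquiv E).exists_trace_eq_of_isIrreducibleCharacter hirr
  have hij : j = i := by
    by_contra hij
    have h1 := hj e
    change _ = (E e j).trace at h1
    rw [he, matrixUnit, Pi.single_eq_of_ne hij, Matrix.trace_zero] at h1
    have h2 : IsIdempotentElem ((Algebra.lsmul k k V : R →ₐ[k] Module.End k V) e) := by
      change _ * _ = _
      rw [← map_mul, hee]
    have h3 := (LinearMap.IsIdempotentElem.trace_eq_zero_iff h2).1 h1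
    have h4 := congrArg Subtype.val (LinearMap.congr_fun h3 ⟨e, heV⟩)
    exact hne (hee ▸ h4)
  subst hij
  convert hirr using 1
  ext r
  exact (hj r).symm

end TraceFunctionals

/-! ### Contractions and subcoalgebras -/

section Subcoalgebras
variable {k : Type u} {A : Type v} [Field k] [Ring A] [HopfAlgebra k A]

/-- The contraction `a ↦ a₁ f(a₂)` of the comultiplication with a linear functional `f`. -/
noncomputable def contractRight (f : A →ₗ[k] k) : A →ₗ[k] A :=
  (TensorProduct.rid k A).toLinearMap ∘ₗ f.lTensor A ∘ₗ comul

theorem apply_contractRight (f g : A →ₗ[k] k) (a : A) :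
    g (contractRight f a) = (WithConv.toConv g * WithConv.toConv f : DualAlgebra k A) a := by
  rw [(ℛ k a).convMul_apply]
  simp only [contractRight, LinearMap.comp_apply]
  conv_lhs => rw [← (ℛ k a).eq]
  simp [mul_comm]

theorem IsSubcoalgebra.contract_mem {D : Submodule k A} (hD : IsSubcoalgebra D) (f : A →ₗ[k] k)
    {x : A} (hx : x ∈ D) : contract f x ∈ D := by
  obtain ⟨y, hy⟩ := hD x hx
  simp only [contract, LinearMap.comp_apply, ← hy]
  clear hy
  induction y with
  | zero => simp
  | add y z hy hz => simpa only [map_add] using D.add_mem hy hz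
  | tmul y z => simpa using D.smul_mem _ z.2

theorem IsSubcoalgebra.contractRight_mem {D : Submodule k A} (hD : IsSubcoalgebra D)
    (f : A →ₗ[k] k) {x : A} (hx : x ∈ D) : contractRight f x ∈ D := by
  obtain ⟨y, hy⟩ := hD x hx
  simp only [contractRight, LinearMap.comp_apply, ← hy]
  clear hy
  induction y with
  | zero => simp
  | add y z hy hz => simpa only [map_add] using D.add_mem hy hz
  | tmul y z => simpa using D.smul_mem _ y.2

theorem tmul_mem_range_map_subtype {D : Submodule k A} {x y : A} (hx : x ∈ D) (hy : y ∈ D) :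
    x ⊗ₜ[k] y ∈ LinearMap.range (TensorProduct.map D.subtype D.subtype) :=
  ⟨(⟨x, hx⟩ : D) ⊗ₜ (⟨y, hy⟩ : D), by simp⟩

end Subcoalgebras

/-! ### Multiplicative matrices -/

section MultiplicativeMatrix
variable {k : Type u} {A : Type v} [Field k] [Ring A] [HopfAlgebra k A]
  {I : Type*} [Fintype I] [DecidableEq I]

/-- A multiplicative matrix: `Δ(m_ab) = ∑ⱼ m_aj ⊗ m_jb` and `ε(m_ab) = δ_ab`. These are the
matrices of coefficients of finite-dimensional comodules with a basis. -/
structure IsMultiplicativeMatrix (m : I → I → A) : Prop where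
  comul_eq : ∀ a b, comul (R := k) (m a b) = ∑ j, m a j ⊗ₜ[k] m j b
  counit_eq : ∀ a b, counit (R := k) (m a b) = if a = b then 1 else 0

namespace IsMultiplicativeMatrix
variable {m : I → I → A} (hm : IsMultiplicativeMatrix (k := k) m)

/-- The matrix representation `f ↦ (f(m_ab))` of `A*` given by a multiplicative matrix. -/
noncomputable def rep : DualAlgebra k A →ₐ[k] Matrix I I k :=
  AlgHom.ofLinearMap
    { toFun := fun f => Matrix.of fun a b => f (m a b)
      map_add' := fun _ _ => rfl
      map_smul' := fun _ _ => rfl }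
    (by
      ext a b
      change (1 : DualAlgebra k A) (m a b) = _
      simp [hm.counit_eq, Matrix.one_apply])
    (fun f g => by
      ext a b
      change (f * g) (m a b) = ∑ j, f (m a j) * g (m j b)
      simp [hm.comul_eq])

@[simp] theorem rep_apply (f : DualAlgebra k A) (a b : I) : hm.rep f a b = f (m a b) := rfl

theorem trace_rep (f : DualAlgebra k A) : (hm.rep f).trace = f (∑ a, m a a) := by
  simp [Matrix.trace]

include hm in
theorem mul {J : Type*} [Fintype J] [DecidableEq J] {m' : J → J → A}
    (hm' : IsMultiplicativeMatrix (k := k) m') :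
    IsMultiplicativeMatrix (k := k) fun p q : I × J => m p.1 q.1 * m' p.2 q.2 where
  comul_eq p q := by
    rw [Bialgebra.comul_mul, hm.comul_eq, hm'.comul_eq, Finset.sum_mul_sum,
      Fintype.sum_prod_type]
    simp
  counit_eq p q := by
    rw [Bialgebra.counit_mul, hm.counit_eq, hm'.counit_eq]
    by_cases h1 : p.1 = q.1 <;> by_cases h2 : p.2 = q.2 <;> simp [Prod.ext_iff, h1, h2]

include hm in
theorem antipode_transpose :
    IsMultiplicativeMatrix (k := k) fun a b => antipode k (m b a) where
  comul_eq a b := by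
    rw [comul_antipode_eq, hm.comul_eq]
    simp
  counit_eq a b := by
    rw [counit_antipode, hm.counit_eq]
    simp [eq_comm]

include hm in
theorem sum_antipode_mul (a b : I) :
    ∑ j, antipode k (m a j) * m j b = if a = b then 1 else 0 := by
  have h := mul_antipode_rTensor_comul_apply (R := k) (m a b)
  rw [hm.comul_eq, hm.counit_eq] at h
  simpa using h

include hm in
theorem sum_mul_antipode (a b : I) :
    ∑ j, m a j * antipode k (m j b) = if a = b then 1 else 0 := by
  have h := mul_antipode_lTensor_comul_apply (R := k) (m a b)
  rw [hm.comul_eq, hm.counit_eq] at h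
  simpa using h

include hm in
/-- The inverse matrix of `m` has entries `S(m_ab)`; if the entries of `m` lie in a
finite-dimensional subalgebra, so do those of the inverse. -/
theorem antipode_mem [FiniteDimensional k A] {Z : Subalgebra k A} (hZ : ∀ a b, m a b ∈ Z)
    (a b : I) : antipode k (m a b) ∈ Z := by
  -- Multiplication by `m` on columns with entries in `Z` is injective, hence onto.
  let L : (I → Z) →ₗ[k] (I → Z) :=
    LinearMap.pi fun a => ∑ b, LinearMap.mulLeft k (⟨m a b, hZ a b⟩ : Z) ∘ₗ LinearMap.proj b
  have hL : ∀ z a, (L z a : A) = ∑ b, m a b * (z b : A) := fun z a => by simp [L]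
  have hleft : ∀ (y z : I → A), (∀ a, ∑ b, m a b * z b = y a) →
      ∀ p, z p = ∑ a, antipode k (m p a) * y a := by
    intro y z h p
    simp_rw [← h, Finset.mul_sum, ← mul_assoc]
    rw [Finset.sum_comm]
    simp_rw [← Finset.sum_mul, hm.sum_antipode_mul]
    simp
  have hinj : Function.Injective L := by
    refine (injective_iff_map_eq_zero _).2 fun z hz => ?_
    funext p
    apply Subtype.ext
    rw [hleft 0 (fun b => (z b : A)) (fun a => by rw [← hL, hz]; rfl) p]
    simp
  obtain ⟨z, hz⟩ := LinearMap.surjective_of_injective hinj (Pi.single b 1)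
  have h := hleft (Pi.single b 1) (fun b => (z b : A)) (fun c => by
    rw [← hL, hz]
    by_cases hc : c = b
    · subst hc; simp
    · simp [Pi.single_eq_of_ne hc]) a
  have h2 : (z a : A) = antipode k (m a b) := by
    rw [h, Finset.sum_eq_single b]
    · simp
    · intro c _ hc; simp [Pi.single_eq_of_ne hc]
    · simp
  rw [← h2]
  exact (z a).2

end IsMultiplicativeMatrix
end MultiplicativeMatrix

/-! ### The comatrix basis of a cosemisimple Hopf algebra -/

section Comatrix
variable {k : Type u} {A : Type v} [Field k] [Ring A] [HopfAlgebra k A] [FiniteDimensional k A]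
  {ι : Type} [Fintype ι] [DecidableEq ι] {n : ι → ℕ}
  (E : DualAlgebra k A ≃ₐ[k] MatrixProduct k n)

/-- The elements of `A` dual to the matrix units of `A*`, for a decomposition `E` of `A*` as a
product of matrix algebras: `f(c^i_ab)` is the `(a, b)` entry of the block `i` of `E f`. -/
noncomputable def comatrix (i : ι) (a b : Fin (n i)) : A :=
  (Module.evalEquiv k A).symm
    { toFun := fun f => E (WithConv.toConv f) i a b
      map_add' := fun f g => by simp
      map_smul' := fun c f => by simp }

omit [Fintype ι] [DecidableEq ι] in
theorem apply_comatrix (f : DualAlgebra k A) (i : ι) (a b : Fin (n i)) :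
    f (comatrix E i a b) = E f i a b :=
  Module.apply_evalEquiv_symm_apply k A f.ofConv _

/-- The functional on `A` taking the coefficient at the comatrix element `c^i_ab`. -/
noncomputable def coeff (i : ι) (a b : Fin (n i)) : DualAlgebra k A :=
  E.symm (matrixUnit k n i a b)

omit [Fintype ι] in
theorem coeff_comatrix (i j : ι) (a b : Fin (n i)) (c d : Fin (n j)) :
    coeff E i a b (comatrix E j c d) =
      if (⟨i, a, b⟩ : Σ i, Fin (n i) × Fin (n i)) = ⟨j, c, d⟩ then 1 else 0 := by
  rw [apply_comatrix, coeff, AlgEquiv.apply_symm_apply, matrixUnit_apply]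

theorem eq_sum_coeff_smul_comatrix (x : A) :
    x = ∑ i, ∑ a, ∑ b, coeff E i a b x • comatrix E i a b := by
  refine eq_of_forall_dual (k := k) fun f => ?_
  have h : (WithConv.toConv f : DualAlgebra k A) =
      ∑ i, ∑ a, ∑ b, E (WithConv.toConv f) i a b • coeff E i a b := by
    apply E.injective
    conv_lhs => rw [matrixProduct_eq_sum (E _)]
    simp [coeff]
  have h2 : ∀ i a b, f (comatrix E i a b) = E (WithConv.toConv f) i a b := fun i a b =>
    apply_comatrix E (WithConv.toConv f) i a b
  simp only [map_sum, map_smul, h2]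
  have h3 := congrArg (fun u : DualAlgebra k A => u x) h
  simp only [WithConv.ofConv_sum, LinearMap.sum_apply, WithConv.ofConv_smul,
    LinearMap.smul_apply, smul_eq_mul] at h3
  rw [h3]
  simp only [smul_eq_mul, mul_comm]

omit [Fintype ι] [DecidableEq ι] in
theorem isMultiplicativeMatrix_comatrix (i : ι) :
    IsMultiplicativeMatrix (k := k) (comatrix E i) where
  comul_eq a b := by
    refine tensor_eq_of_forall_dual fun f g => ?_
    have h := apply_comatrix E (WithConv.toConv f * WithConv.toConv g) i a b
    rw [map_mul, Pi.mul_apply, Matrix.mul_apply] at h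
    simp only [← apply_comatrix] at h
    rw [LinearMap.convMul_apply] at h
    simpa using h
  counit_eq a b := by
    have h := apply_comatrix E 1 i a b
    rw [map_one, Pi.one_apply, Matrix.one_apply] at h
    simpa using h

omit [Fintype ι] in
/-- A subcoalgebra contains all comatrix elements of each block in which one of its elements has a
nonzero coefficient. -/
theorem IsSubcoalgebra.comatrix_mem {D : Submodule k A} (hD : IsSubcoalgebra D) {x : A}
    (hx : x ∈ D) {i : ι} {a b : Fin (n i)} (h : coeff E i a b x ≠ 0) (p q : Fin (n i)) :
    comatrix E i p q ∈ D := by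
  have key : contractRight (coeff E i q b).ofConv (contract (coeff E i a p).ofConv x) =
      coeff E i a b x • comatrix E i p q := by
    refine eq_of_forall_dual (k := k) fun g => ?_
    rw [apply_contractRight]
    have h1 : ∀ u : DualAlgebra k A, u (contract (coeff E i a p).ofConv x) =
        (coeff E i a p * u) x := fun u => apply_contract _ u.ofConv x
    have h2 : coeff E i a p * (WithConv.toConv g * coeff E i q b) =
        g (comatrix E i p q) • coeff E i a b := by
      apply E.injective
      have h3 : g (comatrix E i p q) = E (WithConv.toConv g) i p q :=
        apply_comatrix E (WithConv.toConv g) i p q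
      rw [← mul_assoc, map_mul, map_mul, map_smul, h3]
      simp only [coeff, AlgEquiv.apply_symm_apply, matrixUnit_mul_mul]
    rw [WithConv.toConv_ofConv, h1, h2, map_smul, smul_eq_mul, mul_comm]
    rfl
  have h1 := hD.contractRight_mem (coeff E i q b).ofConv
    (hD.contract_mem (coeff E i a p).ofConv hx)
  rw [key] at h1
  exact (D.smul_mem_iff h).1 h1

/-- The simple subcoalgebra spanned by the comatrix elements of a block. -/
noncomputable def comatrixCoalgebra (i : ι) : Submodule k A :=
  Submodule.span k (Set.range fun p : Fin (n i) × Fin (n i) => comatrix E i p.1 p.2)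

omit [Fintype ι] [DecidableEq ι] in
theorem comatrix_mem_comatrixCoalgebra (i : ι) (a b : Fin (n i)) :
    comatrix E i a b ∈ comatrixCoalgebra E i :=
  Submodule.subset_span ⟨(a, b), rfl⟩

omit [Fintype ι] [DecidableEq ι] in
theorem comatrixCoalgebra_le {i : ι} {D : Submodule k A} (h : ∀ a b, comatrix E i a b ∈ D) :
    comatrixCoalgebra E i ≤ D :=
  Submodule.span_le.2 (by rintro _ ⟨p, rfl⟩; exact h _ _)

omit [Fintype ι] in
theorem coeff_eq_zero_of_mem_comatrixCoalgebra {i j : ι} (hij : i ≠ j) {x : A}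
    (hx : x ∈ comatrixCoalgebra E j) (a b : Fin (n i)) : coeff E i a b x = 0 := by
  have h : comatrixCoalgebra E j ≤ LinearMap.ker (coeff E i a b).ofConv :=
    comatrixCoalgebra_le E fun c d => by
      rw [LinearMap.mem_ker, coeff_comatrix, if_neg]
      exact fun h => hij (congrArg Sigma.fst h)
  exact h hx

theorem exists_coeff_ne_zero {x : A} (hx : x ≠ 0) : ∃ i a b, coeff E i a b x ≠ 0 := by
  by_contra! h
  apply hx
  rw [eq_sum_coeff_smul_comatrix E x]
  simp [h]

omit [FiniteDimensional k A] in
theorem isSubcoalgebra_span {S : Set A} (hS : ∀ s ∈ S, comul (R := k) s ∈ LinearMap.range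
    (TensorProduct.map (Submodule.span k S).subtype (Submodule.span k S).subtype)) :
    IsSubcoalgebra (Submodule.span k S) := fun c hc => by
  have h : Submodule.span k S ≤ (LinearMap.range (TensorProduct.map (Submodule.span k S).subtype
      (Submodule.span k S).subtype)).comap comul := Submodule.span_le.2 hS
  exact h hc

omit [Fintype ι] [DecidableEq ι] in
theorem isSubcoalgebra_comatrixCoalgebra (i : ι) : IsSubcoalgebra (comatrixCoalgebra E i) := by
  refine isSubcoalgebra_span ?_
  rintro _ ⟨p, rfl⟩
  rw [(isMultiplicativeMatrix_comatrix E i).comul_eq]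
  exact Submodule.sum_mem _ fun j _ => tmul_mem_range_map_subtype
    (comatrix_mem_comatrixCoalgebra E i _ _) (comatrix_mem_comatrixCoalgebra E i _ _)

variable [∀ i, NeZero (n i)]

omit [Fintype ι] [∀ i, NeZero (n i)] in
theorem comatrix_ne_zero (i : ι) (a b : Fin (n i)) : comatrix E i a b ≠ 0 := fun h => by
  have h1 := coeff_comatrix E i i a b a b
  rw [h, map_zero, if_pos rfl] at h1
  exact zero_ne_one h1

theorem isSimpleSubcoalgebra_comatrixCoalgebra (i : ι) :
    IsSimpleSubcoalgebra (comatrixCoalgebra E i) where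
  isSubcoalgebra := isSubcoalgebra_comatrixCoalgebra E i
  ne_bot h := comatrix_ne_zero E i 0 0 <| by
    have := comatrix_mem_comatrixCoalgebra E i 0 0
    rwa [h, Submodule.mem_bot] at this
  eq_bot_or_eq D hD hle := by
    refine or_iff_not_imp_left.2 fun hbot => le_antisymm hle ?_
    obtain ⟨x, hx, hx0⟩ := Submodule.exists_mem_ne_zero_of_ne_bot hbot
    obtain ⟨j, a, b, hab⟩ := exists_coeff_ne_zero E hx0
    obtain rfl : j = i := by
      by_contra hji
      exact hab (coeff_eq_zero_of_mem_comatrixCoalgebra E hji (hle hx) a b)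
    exact comatrixCoalgebra_le E fun p q => hD.comatrix_mem E hx hab p q

/-- The irreducible character `∑ₐ c^i_aa` of a block of `A*`, as an element of `A`. -/
noncomputable def blockCharacter (i : ι) : A := ∑ a, comatrix E i a a

omit [Fintype ι] [DecidableEq ι] [∀ i, NeZero (n i)] in
theorem apply_blockCharacter (f : DualAlgebra k A) (i : ι) :
    f (blockCharacter E i) = (E f i).trace := by
  simp [blockCharacter, apply_comatrix, Matrix.trace]

omit [Fintype ι] in
theorem coeff_blockCharacter_self (i : ι) : coeff E i 0 0 (blockCharacter E i) = 1 := by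
  rw [apply_blockCharacter, coeff, AlgEquiv.apply_symm_apply, matrixUnit, Pi.single_eq_same]
  simp

omit [Fintype ι] [DecidableEq ι] [∀ i, NeZero (n i)] in
theorem blockCharacter_mem (i : ι) : blockCharacter E i ∈ comatrixCoalgebra E i :=
  Submodule.sum_mem _ fun a _ => comatrix_mem_comatrixCoalgebra E i a a

theorem irrDual_eq_range [CharZero k] : irrDual k A = Set.range (blockCharacter E) := by
  ext d
  constructor
  · intro hd
    obtain ⟨i, hi⟩ :=
      (isMatrixQuotient_of_algEquiv E).exists_trace_eq_of_isIrreducibleCharacter hd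
    refine ⟨i, eq_of_forall_dual (k := k) fun f => ?_⟩
    exact (apply_blockCharacter E (WithConv.toConv f) i).trans (hi (WithConv.toConv f)).symm
  · rintro ⟨i, rfl⟩
    have : FiniteDimensional k (DualAlgebra k A) :=
      Module.Finite.equiv (WithConv.linearEquiv k (A →ₗ[k] k)).symm
    have h : evalFunctional k (blockCharacter E i) = Matrix.traceLinearMap (Fin (n i)) k k ∘ₗ
        LinearMap.proj i ∘ₗ E.toLinearMap := LinearMap.ext fun f => apply_blockCharacter E f i
    change IsIrreducibleCharacter _
    rw [h]
    exact isIrreducibleCharacter_trace E i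

/-- The character of a multiplicative matrix is a sum of irreducible characters, in which every
block occurs where an entry of the matrix has a nonzero coefficient. The multiplicities are the
ranks of the primitive idempotents of `A*`. -/
theorem IsMultiplicativeMatrix.exists_sum_eq [CharZero k] {I : Type*} [Fintype I] [DecidableEq I]
    {m : I → I → A} (hm : IsMultiplicativeMatrix (k := k) m) :
    ∃ r : ι → ℕ, ∑ a, m a a = ∑ i, r i • blockCharacter E i ∧
      ∀ i a b p q, coeff E i a b (m p q) ≠ 0 → r i ≠ 0 := by
  have hcoeff : ∀ i a b c, coeff E i a b * coeff E i b c = coeff E i a c := fun i a b c =>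
    E.injective (by simp only [coeff, map_mul, AlgEquiv.apply_symm_apply, matrixUnit_mul, if_pos])
  have hidem : ∀ i, IsIdempotentElem (hm.rep (coeff E i 0 0)) := fun i => by
    change _ * _ = _
    rw [← map_mul, hcoeff]
  choose r hr using fun i => exists_nat_matrix_trace_eq (hidem i)
  refine ⟨r, eq_of_forall_dual (k := k) fun f => ?_, fun i a b p q hab hri => hab ?_⟩
  · have h := (isMatrixQuotient_of_algEquiv E).apply_eq_sum
      (τ := Matrix.traceLinearMap I k k ∘ₗ hm.rep.toLinearMap) (x := fun i => coeff E i 0 0)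
      (fun f g => by simp [Matrix.trace_mul_comm (hm.rep f)])
      (fun f hf => by
        rw [show f = 0 from (map_eq_zero_iff _ E.injective).1 hf, map_zero])
      (fun i => E.apply_symm_apply _) (WithConv.toConv f)
    have h2 := hm.trace_rep (WithConv.toConv f)
    change f _ = _
    have h3 : ∀ i, f (blockCharacter E i) = (E (WithConv.toConv f) i).trace := fun i =>
      apply_blockCharacter E (WithConv.toConv f) i
    simp only [LinearMap.comp_apply, AlgHom.toLinearMap_apply, Matrix.traceLinearMap_apply, hr,
      h2] at h
    simp only [map_sum, map_nsmul, h3]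
    simpa using h
  · have h0 : hm.rep (coeff E i 0 0) = 0 := by
      have h1 := hr i
      rw [hri, Nat.cast_zero, ← Matrix.trace_toLin'_eq] at h1
      have h2 : IsIdempotentElem (Matrix.toLin' (hm.rep (coeff E i 0 0))) := by
        change _ * _ = _
        rw [Module.End.mul_eq_comp, ← Matrix.toLin'_mul, (hidem i).eq]
      have h3 := (LinearMap.IsIdempotentElem.trace_eq_zero_iff h2).1 h1
      exact (map_eq_zero_iff _ (Matrix.toLin' (R := k)).injective).1 h3
    have h1 : hm.rep (coeff E i a b) = 0 := by
      rw [← hcoeff i a 0 b, ← hcoeff i a 0 0, map_mul, map_mul, h0, mul_zero, zero_mul]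
    exact congrFun (congrFun h1 p) q

/-- The antipode permutes the irreducible characters: the entries `S(c_ba)` of the dual
multiplicative matrix are linearly independent, so its representation of `A*` is onto. -/
theorem exists_antipode_blockCharacter_eq [CharZero k] [IsSemisimpleRing A] (i : ι) :
    ∃ j, antipode k (blockCharacter E i) = blockCharacter E j := by
  have hm := (isMultiplicativeMatrix_comatrix E i).antipode_transpose
  let S : A ≃ₗ[k] A := LinearEquiv.ofBijective (antipode k)
    ⟨antipode_injective, LinearMap.surjective_of_injective antipode_injective⟩
  have hS : ∀ x, S.symm (antipode k x) = x := fun x => S.symm_apply_apply x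
  have hsurj : ∀ N : Matrix (Fin (n i)) (Fin (n i)) k, ∃ f, hm.rep f = N := by
    intro N
    refine ⟨WithConv.toConv
      ((E.symm (Pi.single i N.transpose)).ofConv ∘ₗ S.symm.toLinearMap), ?_⟩
    ext a b
    rw [hm.rep_apply]
    change (E.symm (Pi.single i N.transpose)).ofConv (S.symm (antipode k _)) = _
    rw [hS, apply_comatrix]
    simp
  obtain ⟨j, hj⟩ := (isMatrixQuotient_of_algEquiv E).exists_trace_eq_of_irreducible
    ((Matrix.toLinAlgEquiv' : Matrix (Fin (n i)) (Fin (n i)) k ≃ₐ[k] _).toAlgHom.comp hm.rep)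
    (fun f hf => by rw [show f = 0 from (map_eq_zero_iff _ E.injective).1 hf, map_zero])
    (fun v hv w => by
      obtain ⟨q, hq⟩ := Function.ne_iff.1 hv
      obtain ⟨f, hf⟩ := hsurj (Matrix.vecMulVec w (Pi.single q (v q)⁻¹))
      refine ⟨f, ?_⟩
      simp only [AlgHom.comp_apply, hf]
      change (Matrix.vecMulVec w (Pi.single q (v q)⁻¹)).mulVec v = w
      rw [Matrix.vecMulVec_mulVec]
      ext p
      simp [inv_mul_cancel₀ hq])
  refine ⟨j, eq_of_forall_dual (k := k) fun f => ?_⟩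
  have h1 := hj (WithConv.toConv f)
  have h2 := hm.trace_rep (WithConv.toConv f)
  have h3 : f (blockCharacter E j) = (E (WithConv.toConv f) j).trace :=
    apply_blockCharacter E (WithConv.toConv f) j
  rw [h3]
  refine Eq.trans ?_ h1
  change _ = LinearMap.trace k _ (Matrix.toLin' (hm.rep (WithConv.toConv f)))
  rw [Matrix.trace_toLin'_eq, h2, blockCharacter, map_sum]

end Comatrix

/-! ### Conjugate characters -/

section ConjugateCharacters
variable {k : Type u} {A : Type v} [Field k] [Ring A] [HopfAlgebra k A]

theorem rightAdjoint_mul_apply (a b x : A) :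
    rightAdjoint k A (a * b) x = rightAdjoint k A b (rightAdjoint k A a x) := by
  have h : ∀ s t : A ⊗[k] A, sandwich k A ((antipode k).rTensor A (s * t)) x =
      sandwich k A ((antipode k).rTensor A t) (sandwich k A ((antipode k).rTensor A s) x) := by
    intro s t
    induction s with
    | zero => simp
    | add s s' hs hs' => simp only [add_mul, map_add, LinearMap.add_apply, hs, hs']
    | tmul y z =>
      induction t with
      | zero => simp
      | add t t' ht ht' => simp only [mul_add, map_add, LinearMap.add_apply, ht, ht']
      | tmul y' z' => simp [antipode_mul_antidistrib, mul_assoc]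
  simp only [rightAdjoint, LinearMap.comp_apply, Bialgebra.comul_mul, h]

variable [FiniteDimensional k A] [IsSemisimpleRing A] {B : Subalgebra k A}
  (hB : IsNormalHopfSubalgebra B)

theorem conjCharacter_mul (d d' : A) (α : B →ₗ[k] k) :
    conjCharacter hB (d * d') α = conjCharacter hB d (conjCharacter hB d' α) := by
  ext x
  have h : hB.adj (d * d') x = hB.adj d' (hB.adj d x) :=
    Subtype.ext (rightAdjoint_mul_apply d d' x)
  simp [conjCharacter, h]

theorem conjCharacter_smul (d : A) (c : k) (α : B →ₗ[k] k) :
    conjCharacter hB d (c • α) = c • conjCharacter hB d α := rfl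

theorem conjCharacter_add (d d' : A) (α : B →ₗ[k] k) :
    conjCharacter hB (d + d') α = conjCharacter hB d α + conjCharacter hB d' α := by
  ext x; simp [conjCharacter]

theorem conjCharacter_zero (α : B →ₗ[k] k) : conjCharacter hB 0 α = 0 := by
  ext x; simp [conjCharacter]

theorem conjCharacter_apply_one (d : A) (α : B →ₗ[k] k) :
    conjCharacter hB d α 1 = counit (R := k) d * α 1 := by
  simp [conjCharacter, hB.adj_one]

/-- If the conjugate of an irreducible character `α` by a sum `e + r` of irreducible characters is
a multiple of `α`, then so is its conjugate by `e`: the conjugates by `e` and by `r` are characters,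
so the irreducible characters of `B` occur in them with nonnegative multiplicities. -/
theorem conjCharacter_eq_of_add [IsAlgClosed k] [CharZero k] {α : B →ₗ[k] k}
    (hα : IsIrreducibleCharacter α) {e r : A} (he : e ∈ irrDual k A)
    (hr : r ∈ AddSubmonoid.closure (irrDual k A)) {c : k}
    (h : conjCharacter hB (e + r) α = c • α) :
    conjCharacter hB e α = counit (R := k) e • α := by
  obtain ⟨m, n, _, π, hπ⟩ := exists_isMatrixQuotient k B
  obtain ⟨x, hx, hπx⟩ := hπ.exists_lift_idempotent
  obtain ⟨i₀, hi₀⟩ := hπ.exists_trace_eq_of_isIrreducibleCharacter hα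
  have hchar : ∀ d ∈ irrDual k A, (∀ i, ∃ N : ℕ, conjCharacter hB d α (x i) = N) ∧
      ∀ b, conjCharacter hB d α b = ∑ i, conjCharacter hB d α (x i) * (π b i).trace := by
    rintro d ⟨W, _, _, _, _, _, -, hd⟩
    obtain ⟨M, _, _, _, _, _, -, rfl⟩ := hα
    simp only [← trace_conjModule hB W M d hd]
    exact ⟨fun i => exists_nat_trace_eq ((hx i).map (conjModule hB W M)),
      fun b => hπ.trace_eq_sum (conjModule hB W M) hπx b⟩
  have hnat : ∀ i, ∃ N : ℕ, conjCharacter hB r α (x i) = N := by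
    intro i
    clear h
    induction hr using AddSubmonoid.closure_induction with
    | mem d hd => exact (hchar d hd).1 i
    | zero => exact ⟨0, by simp [conjCharacter_zero]⟩
    | add d d' _ _ ih ih' =>
      obtain ⟨N, hN⟩ := ih
      obtain ⟨N', hN'⟩ := ih'
      exact ⟨N + N', by rw [conjCharacter_add, LinearMap.add_apply, hN, hN', Nat.cast_add]⟩
  have hzero : ∀ i, i ≠ i₀ → conjCharacter hB e α (x i) = 0 := by
    intro i hi
    obtain ⟨N, hN⟩ := (hchar e he).1 i
    obtain ⟨N', hN'⟩ := hnat i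
    have h1 := LinearMap.congr_fun h (x i)
    rw [conjCharacter_add, LinearMap.add_apply, LinearMap.smul_apply, hi₀, hπx, matrixUnit,
      Pi.single_eq_of_ne (Ne.symm hi), Matrix.trace_zero, smul_zero, hN, hN', ← Nat.cast_add,
      Nat.cast_eq_zero] at h1
    rw [hN, Nat.eq_zero_of_add_eq_zero_right h1, Nat.cast_zero]
  have hmul : ∀ b, conjCharacter hB e α b = conjCharacter hB e α (x i₀) * α b := by
    intro b
    rw [(hchar e he).2 b, Finset.sum_eq_single i₀ (fun i _ hi => by rw [hzero i hi, zero_mul])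
      (by simp), hi₀]
  have hα1 : α 1 ≠ 0 := by
    rw [hi₀, map_one]
    simp [NeZero.ne]
  have hc : conjCharacter hB e α (x i₀) = counit (R := k) e := by
    have h1 := hmul 1
    rw [conjCharacter_apply_one] at h1
    exact (mul_right_cancel₀ hα1 h1).symm
  ext b
  rw [hmul, hc]
  rfl

end ConjugateCharacters

/-! ### The stabilizer -/

section Stabilizer
variable {k : Type u} {A : Type v} [Field k] [Ring A] [HopfAlgebra k A] [FiniteDimensional k A]
  {ι : Type} [Fintype ι] [DecidableEq ι] {n : ι → ℕ} [∀ i, NeZero (n i)]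
  (E : DualAlgebra k A ≃ₐ[k] MatrixProduct k n)

/-- A product of irreducible characters is a sum of irreducible characters, in which every block
occurs that has a nonzero coefficient in a product of the corresponding comatrix elements. -/
theorem exists_blockCharacter_mul_eq [CharZero k] (i j : ι) :
    ∃ r : ι → ℕ, blockCharacter E i * blockCharacter E j = ∑ l, r l • blockCharacter E l ∧
      ∀ l p q a b c d, coeff E l p q (comatrix E i a b * comatrix E j c d) ≠ 0 → r l ≠ 0 := by
  obtain ⟨r, hr, hne⟩ := ((isMultiplicativeMatrix_comatrix E i).mul
    (isMultiplicativeMatrix_comatrix E j)).exists_sum_eq E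
  refine ⟨r, ?_, fun l p q a b c d h => hne l p q (a, c) (b, d) h⟩
  rw [← hr, Fintype.sum_prod_type, blockCharacter, blockCharacter, Finset.sum_mul_sum]

theorem blockCharacter_mem_irrDual [CharZero k] (i : ι) : blockCharacter E i ∈ irrDual k A := by
  rw [irrDual_eq_range E]
  exact Set.mem_range_self i

include E in
theorem mul_mem_closure_irrDual [CharZero k] {d d' : A} (hd : d ∈ irrDual k A)
    (hd' : d' ∈ irrDual k A) : d * d' ∈ AddSubmonoid.closure (irrDual k A) := by
  rw [irrDual_eq_range E] at *
  obtain ⟨i, rfl⟩ := hd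
  obtain ⟨j, rfl⟩ := hd'
  obtain ⟨r, hr, -⟩ := exists_blockCharacter_mul_eq E i j
  rw [hr]
  exact sum_mem fun l _ => nsmul_mem (AddSubmonoid.subset_closure (Set.mem_range_self l)) _

/-- The span of the comatrix elements of the blocks with character in `X`, as the space of all
elements whose other coefficients vanish. -/
noncomputable def blockSpan (X : Set A) : Submodule k A where
  carrier := {x | ∀ i a b, coeff E i a b x ≠ 0 → blockCharacter E i ∈ X}
  add_mem' := fun {x y} hx hy i a b h => by
    by_cases h0 : coeff E i a b x = 0
    · exact hy i a b fun h1 => h (by rw [map_add, h0, h1, add_zero])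
    · exact hx i a b h0
  zero_mem' := fun i a b h => absurd (map_zero _) h
  smul_mem' := fun c x hx i a b h => hx i a b fun h1 => h (by rw [map_smul, h1, smul_zero])

variable {E} {X : Set A}

omit [Fintype ι] [∀ i, NeZero (n i)] in
theorem blockCharacter_mem_of_mem_blockSpan {x : A} (hx : x ∈ blockSpan E X) {i : ι}
    {a b : Fin (n i)} (h : coeff E i a b x ≠ 0) : blockCharacter E i ∈ X :=
  hx i a b h

omit [Fintype ι] [∀ i, NeZero (n i)] in
theorem comatrixCoalgebra_le_blockSpan {i : ι} (hi : blockCharacter E i ∈ X) :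
    comatrixCoalgebra E i ≤ blockSpan E X := fun x hx j a b h => by
  by_cases hij : j = i
  · rwa [hij]
  · exact absurd (coeff_eq_zero_of_mem_comatrixCoalgebra E hij hx a b) h

omit [∀ i, NeZero (n i)] in
theorem blockSpan_le {D : Submodule k A}
    (hD : ∀ i, blockCharacter E i ∈ X → comatrixCoalgebra E i ≤ D) : blockSpan E X ≤ D := by
  intro x hx
  rw [eq_sum_coeff_smul_comatrix E x]
  refine sum_mem fun i _ => sum_mem fun a _ => sum_mem fun b _ => ?_
  by_cases h : coeff E i a b x = 0
  · rw [h, zero_smul]; exact zero_mem _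
  · exact D.smul_mem _ (hD i (hx i a b h) (comatrix_mem_comatrixCoalgebra E i a b))

theorem simpleSubcoalgebrasOf_eq [CharZero k] (hX : X ⊆ irrDual k A) :
    simpleSubcoalgebrasOf (k := k) X = comatrixCoalgebra E '' {i | blockCharacter E i ∈ X} := by
  ext C
  constructor
  · rintro ⟨hC, d, hd, hdC⟩
    obtain ⟨i, rfl⟩ := (irrDual_eq_range E) ▸ hX hd
    refine ⟨i, hd, (hC.eq_bot_or_eq _ (isSubcoalgebra_comatrixCoalgebra E i) ?_).resolve_left
      (isSimpleSubcoalgebra_comatrixCoalgebra E i).ne_bot⟩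
    refine comatrixCoalgebra_le E (hC.isSubcoalgebra.comatrix_mem E hdC (a := 0) (b := 0) ?_)
    rw [coeff_blockCharacter_self]
    exact one_ne_zero
  · rintro ⟨i, hi, rfl⟩
    exact ⟨isSimpleSubcoalgebra_comatrixCoalgebra E i, _, hi, blockCharacter_mem E i⟩

theorem blockSpan_eq_sSup [CharZero k] (hX : X ⊆ irrDual k A) :
    blockSpan E X = sSup (simpleSubcoalgebrasOf X) := by
  rw [simpleSubcoalgebrasOf_eq (E := E) hX]
  refine le_antisymm (blockSpan_le fun i hi => le_sSup ⟨i, hi, rfl⟩) (sSup_le ?_)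
  rintro _ ⟨i, hi, rfl⟩
  exact comatrixCoalgebra_le_blockSpan hi

variable (E) in
include E in
theorem sSupIndep_simpleSubcoalgebrasOf [CharZero k] (hX : X ⊆ irrDual k A) :
    sSupIndep (simpleSubcoalgebrasOf (k := k) X) := by
  rw [simpleSubcoalgebrasOf_eq (E := E) hX]
  rintro _ ⟨i, hi, rfl⟩
  rw [Submodule.disjoint_def]
  intro x hx hx'
  by_contra hx0
  obtain ⟨j, a, b, h⟩ := exists_coeff_ne_zero E hx0
  by_cases hji : j = i
  · subst hji
    have hle : sSup (comatrixCoalgebra E '' {i | blockCharacter E i ∈ X} \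
        {comatrixCoalgebra E j}) ≤ LinearMap.ker (coeff E j a b).ofConv := by
      refine sSup_le ?_
      rintro _ ⟨⟨l, -, rfl⟩, hne⟩ y hy
      exact coeff_eq_zero_of_mem_comatrixCoalgebra E (fun hjl => hne (by rw [hjl]; rfl)) hy a b
    exact h (hle hx')
  · exact h (coeff_eq_zero_of_mem_comatrixCoalgebra E hji hx a b)

theorem mul_mem_blockSpan [CharZero k] (hX : IsClosedUnderMul k X) {x y : A}
    (hx : x ∈ blockSpan E X) (hy : y ∈ blockSpan E X) : x * y ∈ blockSpan E X := by
  let G : Set A := {z | ∃ i a b, blockCharacter E i ∈ X ∧ comatrix E i a b = z}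
  have hG : blockSpan E X ≤ Submodule.span k G := blockSpan_le fun i hi =>
    comatrixCoalgebra_le E fun a b => Submodule.subset_span ⟨i, a, b, hi, rfl⟩
  have h1 := Submodule.mul_mem_mul (hG hx) (hG hy)
  rw [Submodule.span_mul_span] at h1
  refine Submodule.span_le.2 ?_ h1
  rintro _ ⟨_, ⟨i, a, b, hi, rfl⟩, _, ⟨j, c, d, hj, rfl⟩, rfl⟩ l p q h
  obtain ⟨r, hr, hne⟩ := exists_blockCharacter_mul_eq E i j
  have hrl := hne l p q a b c d h
  have hirr := blockCharacter_mem_irrDual E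
  refine (hX _ hi _ hj).2 _ ⟨hirr l, (r l - 1) • blockCharacter E l +
    ∑ m ∈ Finset.univ.erase l, r m • blockCharacter E m, ?_, ?_⟩
  · exact add_mem (nsmul_mem (AddSubmonoid.subset_closure (hirr l)) _) (sum_mem fun m _ =>
      nsmul_mem (AddSubmonoid.subset_closure (hirr m)) _)
  · rw [hr, ← add_assoc, ← succ_nsmul', Nat.sub_add_cancel (Nat.pos_of_ne_zero hrl),
      Finset.add_sum_erase _ (fun m => r m • blockCharacter E m) (Finset.mem_univ l)]

variable (E) in
/-- The Hopf subalgebra generated by a multiplicatively closed set `X` of irreducible characters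
such that `1` is a combination of the blocks with character in `X`. -/
noncomputable def blockSubalgebra [CharZero k] (hX : IsClosedUnderMul k X)
    (h1 : (1 : A) ∈ blockSpan E X) : Subalgebra k A :=
  (blockSpan E X).toSubalgebra h1 fun _ _ => mul_mem_blockSpan hX

theorem isHopfSubalgebra_blockSubalgebra [CharZero k] (hX : IsClosedUnderMul k X)
    (h1 : (1 : A) ∈ blockSpan E X) : IsHopfSubalgebra (blockSubalgebra E hX h1) where
  comul_mem := by
    have h : blockSpan E X ≤ (LinearMap.range (TensorProduct.map (blockSpan E X).subtype
        (blockSpan E X).subtype)).comap comul := by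
      refine blockSpan_le fun i hi => comatrixCoalgebra_le E fun a b => ?_
      have hmem := fun a b => comatrixCoalgebra_le_blockSpan hi
        (comatrix_mem_comatrixCoalgebra E i a b)
      rw [Submodule.mem_comap, (isMultiplicativeMatrix_comatrix E i).comul_eq]
      exact sum_mem fun j _ => tmul_mem_range_map_subtype (hmem _ _) (hmem _ _)
    exact h
  antipode_mem := by
    have h : blockSpan E X ≤ (blockSpan E X).comap (antipode k) := by
      refine blockSpan_le fun i hi => comatrixCoalgebra_le E fun a b => ?_
      exact (isMultiplicativeMatrix_comatrix E i).antipode_mem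
        (Z := blockSubalgebra E hX h1) (fun a b => comatrixCoalgebra_le_blockSpan hi
          (comatrix_mem_comatrixCoalgebra E i a b)) a b
    exact h

omit [FiniteDimensional k A] in
theorem IsHopfSubalgebra.isSubcoalgebra {H : Subalgebra k A} (hH : IsHopfSubalgebra H) :
    IsSubcoalgebra (Subalgebra.toSubmodule H) :=
  hH.comul_mem

/-- A Hopf subalgebra contains the blocks of the irreducible characters it contains. -/
theorem blockSpan_le_of_isHopfSubalgebra {H : Subalgebra k A} (hH : IsHopfSubalgebra H)
    (hXH : X ⊆ H) : blockSpan E X ≤ Subalgebra.toSubmodule H :=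
  blockSpan_le fun i hi => comatrixCoalgebra_le E <|
    hH.isSubcoalgebra.comatrix_mem E (hXH hi) (a := 0) (b := 0) <| by
      rw [coeff_blockCharacter_self]
      exact one_ne_zero

variable [IsSemisimpleRing A] {B : Subalgebra k A} (hB : IsNormalHopfSubalgebra B)

theorem isClosedUnderMul_stabilizerSet [IsAlgClosed k] [CharZero k]
    (E : DualAlgebra k A ≃ₐ[k] MatrixProduct k n) {α : B →ₗ[k] k}
    (hα : IsIrreducibleCharacter α) : IsClosedUnderMul k (stabilizerSet hB α) := by
  rintro d ⟨hd, hdα⟩ d' ⟨hd', hdα'⟩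
  refine ⟨mul_mem_closure_irrDual E hd hd', ?_⟩
  rintro e ⟨he, r, hr, hsum⟩
  refine ⟨he, conjCharacter_eq_of_add hB hα he hr
    (c := counit (R := k) d' * counit (R := k) d) ?_⟩
  rw [← hsum, conjCharacter_mul, hdα', conjCharacter_smul, hdα, smul_smul]

omit [Fintype ι] [DecidableEq ι] [∀ i, NeZero (n i)] in
/-- An irreducible character `d` whose block lies in `B` stabilizes every character `α` of `B`:
`α(S(d₁) x d₂) = α(x d₂ S(d₁)) = α(x d₁ S(d₂)) = ε(d) α(x)`, as `d` is cocommutative. -/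
theorem conjCharacter_blockCharacter_of_le {α : B →ₗ[k] k} (hα : IsIrreducibleCharacter α) {i : ι}
    (hi : ∀ a b, comatrix E i a b ∈ B) :
    conjCharacter hB (blockCharacter E i) α = counit (R := k) (blockCharacter E i) • α := by
  have hcomm : ∀ x y, α (x * y) = α (y * x) := by
    obtain ⟨M, _, _, _, _, _, -, rfl⟩ := hα
    intro x y
    simp only [moduleCharacter, LinearMap.comp_apply, AlgHom.toLinearMap_apply, map_mul]
    exact LinearMap.trace_mul_comm k _ _
  have hm := isMultiplicativeMatrix_comatrix E i
  let c : Fin (n i) → Fin (n i) → B := fun a b => ⟨comatrix E i a b, hi a b⟩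
  let s : Fin (n i) → Fin (n i) → B := fun a b =>
    ⟨antipode k (comatrix E i a b), hB.antipode_mem _ (hi a b)⟩
  ext x
  have hadj : hB.adj (blockCharacter E i) x = ∑ a, ∑ j, s a j * x * c j a := by
    apply Subtype.ext
    rw [hB.coe_adj, blockCharacter, map_sum, LinearMap.sum_apply]
    simp [rightAdjoint, hm.comul_eq, s, c]
  have hcs : ∀ j, ∑ a, c j a * s a j = 1 := fun j => by
    apply Subtype.ext
    simpa [s, c] using hm.sum_mul_antipode j j
  have hε : counit (R := k) (blockCharacter E i) = ∑ _j : Fin (n i), 1 := by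
    simp [blockCharacter, hm.counit_eq]
  rw [conjCharacter, LinearMap.comp_apply, hadj, LinearMap.smul_apply, hε, Finset.sum_comm,
    Finset.sum_smul, map_sum]
  refine Finset.sum_congr rfl fun j _ => ?_
  rw [map_sum, one_smul]
  simp_rw [mul_assoc, hcomm (s _ j), mul_assoc]
  rw [← map_sum, ← Finset.mul_sum, hcs, mul_one]

theorem le_blockSpan_stabilizerSet [CharZero k] {α : B →ₗ[k] k}
    (hα : IsIrreducibleCharacter α) :
    Subalgebra.toSubmodule B ≤ blockSpan E (stabilizerSet hB α) := fun x hx i a b h => by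
  refine ⟨blockCharacter_mem_irrDual E i, ?_⟩
  exact conjCharacter_blockCharacter_of_le hB hα fun p q =>
    hB.toIsHopfSubalgebra.isSubcoalgebra.comatrix_mem E hx h p q

end Stabilizer
end HopfClifford

theorem mainTheorem6 {k : Type*} {A : Type*} [Field k] [IsAlgClosed k] [CharZero k]
    [Ring A] [HopfAlgebra k A] [FiniteDimensional k A] [IsSemisimpleRing A]
    (B : Subalgebra k A) (hB : HopfClifford.IsNormalHopfSubalgebra B)
    (α : B →ₗ[k] k) (hα : HopfClifford.IsIrreducibleCharacter α) :
    HopfClifford.IsClosedUnderMul k (HopfClifford.stabilizerSet hB α) ∧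
    HopfClifford.IsClosedUnderStar k (HopfClifford.stabilizerSet hB α) ∧
    ∃ Z : Subalgebra k A,
      IsLeast {H : Subalgebra k A | HopfClifford.IsHopfSubalgebra H ∧
        HopfClifford.stabilizerSet hB α ⊆ H} Z ∧
      sSupIndep (HopfClifford.simpleSubcoalgebrasOf (k := k)
        (HopfClifford.stabilizerSet hB α)) ∧
      Subalgebra.toSubmodule Z = sSup (HopfClifford.simpleSubcoalgebrasOf
        (HopfClifford.stabilizerSet hB α)) ∧
      B ≤ Z := by
  open HopfClifford in
  have : FiniteDimensional k (DualAlgebra k A) :=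
    Module.Finite.equiv (WithConv.linearEquiv k (A →ₗ[k] k)).symm
  have := isSemisimpleRing_dualAlgebra (k := k) (A := A)
  obtain ⟨r, n, hn, ⟨E⟩⟩ :=
    IsSemisimpleRing.exists_algEquiv_pi_matrix_of_isAlgClosed k (DualAlgebra k A)
  have hX : stabilizerSet hB α ⊆ irrDual k A := fun d hd => hd.1
  have hmul := isClosedUnderMul_stabilizerSet hB E hα
  have hBZ := le_blockSpan_stabilizerSet (E := E) hB hα
  have hZ := isHopfSubalgebra_blockSubalgebra hmul (hBZ B.one_mem)
  have hXZ : ∀ d ∈ stabilizerSet hB α, d ∈ blockSpan E (stabilizerSet hB α) := by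
    intro d hd
    obtain ⟨i, rfl⟩ := (irrDual_eq_range E) ▸ hX hd
    exact comatrixCoalgebra_le_blockSpan hd (blockCharacter_mem E i)
  refine ⟨hmul, ?_, blockSubalgebra E hmul (hBZ B.one_mem), ⟨⟨hZ, hXZ⟩, ?_⟩,
    sSupIndep_simpleSubcoalgebrasOf E hX, blockSpan_eq_sSup hX, hBZ⟩
  · intro d hd
    obtain ⟨i, rfl⟩ := (irrDual_eq_range E) ▸ hX hd
    have h := hZ.antipode_mem _ (hXZ _ hd)
    obtain ⟨j, hj⟩ := exists_antipode_blockCharacter_eq E i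
    rw [hj] at h ⊢
    refine blockCharacter_mem_of_mem_blockSpan h (a := 0) (b := 0) ?_
    rw [coeff_blockCharacter_self]
    exact one_ne_zero
  · rintro H ⟨hH, hXH⟩
    exact blockSpan_le_of_isHopfSubalgebra hH hXH
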